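/- All graphs are finite, simple and undirected, with $n$ vertices and $m$ edges. A clique split of a graph $G$ is a partition of $V(G)$ into cliques $H, H_1, \dots, H_k$ of $G$ ($k \ge 0$; the peripheral cliques $H_i$ are nonempty, the center $H$ may be empty) such that no edge of $G$ joins $H_i$ to $H_j$ for $i \ne j$. A graph is unipolar if it has a clique split, co-unipolar if its complement $\overline{G}$ is unipolar, and a generalized split graph if it is unipolar or co-unipolar. Write $\alpha(G)$ for the independence number. A clique cover is a family of cliques whose union is $V(G)$; its size is the number of cliques. (1) Let $H, H_1, \dots, H_k$ be a clique split of $G$. If some vertex of $H$ has a non-neighbor in every $H_i$, then $\alpha(G) = k+1$; otherwise $\alpha(G) = k$. (2) There are algorithms on a random access machine which, given the adjacency lists of a unipolar graph $G$ and a clique split of $G$, find in time $O(n+m)$ (a) a maximum independent set of $G$; (b) a minimum clique cover of $G$, of size $\alpha(G)$, in the form of a partition of $V(G)$ into $\alpha(G)$ cliques. (3) There are algorithms on a random access machine which, given the adjacency lists of a co-unipolar graph $G$ and a clique split of $\overline{G}$, find in time $O(n+m)$, where $m$ is the number of edges of $G$ itself, (a) a maximum clique of $G$; (b) a minimum proper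 coloring of $G$. Thus, on generalized split graphs, maximum independent set and minimum clique cover (when a clique split of $G$ is given), and maximum clique and minimum coloring (when a clique split of $\overline{G}$ is given), are solvable in time $O(n+m)$. Here $O(n+m)$ means at most $C(n+m+1)$ unit-cost steps, with one constant $C$ for all inputs. The machine works on natural numbers with indirectly addressed memory, and its arithmetic is successor and predecessor only. -/

import Mathlib

namespace UnipolarAlg

/-! ### Clique splits and clique covers -/

/-- `H, P 0, …, P (k-1)` is a clique split of `G` with center `H` and `k` peripheral cliques:
these sets are cliques that partition the vertex set, and no edge joins two different peripheral
cliques. Peripheral cliques are nonempty, being parts of a partition; the center may be empty,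
which only makes the notion more general. -/
structure IsCliqueSplit {V : Type*} (G : SimpleGraph V) {k : ℕ} (H : Set V) (P : Fin k → Set V) :
    Prop where
  center_isClique : G.IsClique H
  periph_isClique : ∀ i, G.IsClique (P i)
  periph_nonempty : ∀ i, (P i).Nonempty
  cover : ∀ v, v ∈ H ∨ ∃ i, v ∈ P i
  center_disjoint : ∀ i, Disjoint H (P i)
  periph_disjoint : ∀ i j, i ≠ j → Disjoint (P i) (P j)
  no_edges : ∀ i j, i ≠ j → ∀ x ∈ P i, ∀ y ∈ P j, ¬ G.Adj x y

/-- `K 0, …, K (r-1)` is a clique cover of `G` of size `r`. -/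
def IsCliqueCover {V : Type*} (G : SimpleGraph V) {r : ℕ} (K : Fin r → Set V) : Prop :=
  (∀ i, G.IsClique (K i)) ∧ ∀ v, ∃ i, v ∈ K i

/-- A clique cover of the least possible size. -/
def IsMinimumCliqueCover {V : Type*} (G : SimpleGraph V) {r : ℕ} (K : Fin r → Set V) : Prop :=
  IsCliqueCover G K ∧ ∀ (r' : ℕ) (K' : Fin r' → Set V), IsCliqueCover G K' → r ≤ r'

/-! ### A random access machine

The machine has registers, and arrays of registers that are addressed indirectly through a
register. All of them hold natural numbers, and a program names finitely many registers and arrays.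
The only arithmetic is successor and predecessor, so after `t` steps every stored number exceeds
the numbers in the input and in the program by at most `t`. In particular a computation of linear
length only uses words of logarithmic length, and the unit cost of an instruction is justified. -/

/-- A memory state: the contents of register `x` is `reg x`, and that of cell `i` of array `a` is
`arr a i`. -/
structure State where
  reg : ℕ → ℕ
  arr : ℕ → ℕ → ℕ

/-- Tests comparing two registers. -/
inductive Test where
  | eq (x y : ℕ)
  | lt (x y : ℕ)

/-- The outcome of a test in a memory state. -/
def Test.Holds : Test → State → Prop
  | .eq x y, s => s.reg x = s.reg y
  | .lt x y, s => s.reg x < s.reg y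

/-- Programs; `x`, `y`, `i` are names of registers, `a` is the name of an array, and `c` is a
numerical constant. -/
inductive Prog where
  | skip
  | const (x c : ℕ)
  | copy (x y : ℕ)
  | succ (x : ℕ)
  | pred (x : ℕ)
  | load (x a i : ℕ)
  | store (a i x : ℕ)
  | seq (p q : Prog)
  | ite (b : Test) (p q : Prog)
  | while (b : Test) (p : Prog)

/-- Overwrite register `x`. -/
def State.setReg (s : State) (x v : ℕ) : State :=
  { s with reg := Function.update s.reg x v }

/-- Overwrite cell `j` of array `a`. -/
def State.setArr (s : State) (a j v : ℕ) : State :=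
  { s with arr := Function.update s.arr a (Function.update (s.arr a) j v) }

/-- `Exec p s s' t`: started in state `s`, the program `p` halts in state `s'` after exactly `t`
steps. Every instruction and every evaluation of a test is one step. -/
inductive Exec : Prog → State → State → ℕ → Prop where
  | skip (s : State) : Exec .skip s s 1
  | const (x c : ℕ) (s : State) : Exec (.const x c) s (s.setReg x c) 1
  | copy (x y : ℕ) (s : State) : Exec (.copy x y) s (s.setReg x (s.reg y)) 1
  | succ (x : ℕ) (s : State) : Exec (.succ x) s (s.setReg x (s.reg x + 1)) 1
  | pred (x : ℕ) (s : State) : Exec (.pred x) s (s.setReg x (s.reg x - 1)) 1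
  | load (x a i : ℕ) (s : State) : Exec (.load x a i) s (s.setReg x (s.arr a (s.reg i))) 1
  | store (a i x : ℕ) (s : State) : Exec (.store a i x) s (s.setArr a (s.reg i) (s.reg x)) 1
  | seq {p q : Prog} {s s' s'' : State} {t t' : ℕ} :
      Exec p s s' t → Exec q s' s'' t' → Exec (.seq p q) s s'' (t + t')
  | ite_true {b : Test} {p q : Prog} {s s' : State} {t : ℕ} :
      b.Holds s → Exec p s s' t → Exec (.ite b p q) s s' (t + 1)
  | ite_false {b : Test} {p q : Prog} {s s' : State} {t : ℕ} :
      ¬ b.Holds s → Exec q s s' t → Exec (.ite b p q) s s' (t + 1)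
  | while_true {b : Test} {p : Prog} {s s' s'' : State} {t t' : ℕ} :
      b.Holds s → Exec p s s' t → Exec (.while b p) s' s'' t' →
      Exec (.while b p) s s'' (t + t' + 1)
  | while_false {b : Test} {p : Prog} {s : State} :
      ¬ b.Holds s → Exec (.while b p) s s 1

/-! ### Input and output -/

/-- The initial state `s` holds the graph `G` on the vertices `0, …, n-1`, given by adjacency lists,
and a family `H, P 0, …, P (k-1)` of sets of vertices:
register `0` is `n` and register `1` is `k`;
the neighbors of `v` are listed once each, in any order, in the cells `j` of array `1` with
`arr 0 v ≤ j < arr 0 (v + 1)`, and these lists follow one another from cell `0` on;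
cell `v` of array `2` is `0` if `v ∈ H` and `i + 1` if `v ∈ P i`.
The other registers and arrays are zero. -/
structure Encodes {n k : ℕ} (G : SimpleGraph (Fin n)) (H : Set (Fin n)) (P : Fin k → Set (Fin n))
    (s : State) : Prop where
  reg_n : s.reg 0 = n
  reg_k : s.reg 1 = k
  reg_other : ∀ x, 2 ≤ x → s.reg x = 0
  arr_other : ∀ a, 3 ≤ a → ∀ j, s.arr a j = 0
  off_zero : s.arr 0 0 = 0
  off_le : ∀ v : Fin n, s.arr 0 v ≤ s.arr 0 (v + 1)
  adj : ∀ v : Fin n, Set.BijOn (s.arr 1) (Set.Ico (s.arr 0 v) (s.arr 0 (v + 1)))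
    ((fun w : Fin n => (w : ℕ)) '' G.neighborSet v)
  center : ∀ v ∈ H, s.arr 2 v = 0
  periph : ∀ i, ∀ v ∈ P i, s.arr 2 v = i + 1

/-- The final state holds the vertex set `S`: register `0` is its size, and array `3` is its
indicator function. -/
def OutputsSet {n : ℕ} (s : State) (S : Finset (Fin n)) : Prop :=
  s.reg 0 = S.card ∧ ∀ v : Fin n, s.arr 3 v = if v ∈ S then 1 else 0

/-- The final state holds a partition of the vertices into parts `0, …, r-1`: register `0` is `r`,
and cell `v` of array `3` is the index of the part of the vertex `v`. -/
def OutputsParts {n : ℕ} (s : State) (r : ℕ) (part : Fin n → Fin r) : Prop :=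
  s.reg 0 = r ∧ ∀ v : Fin n, s.arr 3 v = part v

/-- The program `p` solves in time `O(n + m)` the following problem on graphs with `n` vertices and
`m` edges: given a graph `G`, by adjacency lists, and a family `H, P` satisfying
`Valid G H P`, halt in a state `s'` with `Out G s'`. -/
def SolvesInLinearTime (p : Prog)
    (Valid : ∀ {n k : ℕ}, SimpleGraph (Fin n) → Set (Fin n) → (Fin k → Set (Fin n)) → Prop)
    (Out : ∀ {n : ℕ}, SimpleGraph (Fin n) → State → Prop) : Prop :=
  ∃ C : ℕ, ∀ (n k : ℕ) (G : SimpleGraph (Fin n)) (H : Set (Fin n)) (P : Fin k → Set (Fin n))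
    (s : State), Valid G H P → Encodes G H P s →
    ∃ (s' : State) (t : ℕ), Exec p s s' t ∧ t ≤ C * (n + G.edgeSet.ncard + 1) ∧ Out G s'

end UnipolarAlg

namespace UnipolarAlg

/-! ### Reasoning about programs -/

-- Color the center `0` and the peripheral cliques `1, …, k`. A host of a center vertex is a
-- peripheral clique to which it is completely adjacent; a center vertex without a host is called
-- free.
--
-- If there is no free vertex, moving each center vertex into a host partitions the graph into `k`
-- cliques, while one vertex from each peripheral clique gives an independent set of size `k`. If
-- `x` is free, `x` together with a non-neighbor from each peripheral clique is independent of size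
-- `k + 1`, and the color classes are at most `k + 1` cliques covering everything. An independent
-- set meets a clique at most once, so in both cases the set and the cover certify each other's
-- optimality (`card_le_of_cliques`, `indepNum_eq`). The algorithms therefore only need a host map
-- and, if one exists, a free vertex.
--
-- For a split of `G`, a class is a host of `v` when it contains as many neighbors of `v` as
-- vertices (`findsHost_fullClass`); only classes of listed neighbors need be inspected, since
-- classes are nonempty. For a split of the complement, with adjacency lists of `G`, a host is a
-- class containing no neighbor of `v`. By pigeonhole the least positive number that is not the
-- class of a neighbor is at most `deg v + 1`, so linear search finds it within the budget
-- (`findsHost_missedClass`). Each center vertex costs `O(deg v + 1)`, including erasing its counts,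
-- and the degrees sum to `2 * m` (`Encodes.off_last`).
--
-- A relation `R`, either adjacency or its negation, lets one development serve both cases: maximum
-- cliques and colorings of `G` are maximum independent sets and clique covers of `Gᶜ`, but no
-- adjacency list of `Gᶜ` is ever built.

infixr:60 " ;; " => Prog.seq

@[simp] theorem State.setReg_reg (s : State) (x v y : ℕ) :
    (s.setReg x v).reg y = if y = x then v else s.reg y := by
  simp [State.setReg, Function.update_apply]

@[simp] theorem State.setReg_arr (s : State) (x v : ℕ) : (s.setReg x v).arr = s.arr := rfl

@[simp] theorem State.setArr_reg (s : State) (a j v : ℕ) : (s.setArr a j v).reg = s.reg := rfl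

@[simp] theorem State.setArr_arr (s : State) (a j v b : ℕ) :
    (s.setArr a j v).arr b = if b = a then Function.update (s.arr a) j v else s.arr b := by
  simp [State.setArr, Function.update_apply]

/-- The program never writes to register `x`. -/
def Prog.KeepsReg (x : ℕ) : Prog → Bool
  | .skip => true
  | .const y _ => y != x
  | .copy y _ => y != x
  | .succ y => y != x
  | .pred y => y != x
  | .load y _ _ => y != x
  | .store _ _ _ => true
  | .seq p q => p.KeepsReg x && q.KeepsReg x
  | .ite _ p q => p.KeepsReg x && q.KeepsReg x
  | .while _ p => p.KeepsReg x

/-- The program never writes to array `a`. -/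
def Prog.KeepsArr (a : ℕ) : Prog → Bool
  | .store b _ _ => b != a
  | .seq p q => p.KeepsArr a && q.KeepsArr a
  | .ite _ p q => p.KeepsArr a && q.KeepsArr a
  | .while _ p => p.KeepsArr a
  | _ => true

/-- The states agree on everything that `p` never writes to. -/
structure Prog.Frame (p : Prog) (s s' : State) : Prop where
  reg : ∀ x, p.KeepsReg x = true → s'.reg x = s.reg x
  arr : ∀ a, p.KeepsArr a = true → s'.arr a = s.arr a

theorem Prog.Frame.refl (p : Prog) (s : State) : p.Frame s s := ⟨fun _ _ => rfl, fun _ _ => rfl⟩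

theorem Prog.Frame.trans {p : Prog} {s s' s'' : State} (h : p.Frame s s') (h' : p.Frame s' s'') :
    p.Frame s s'' :=
  ⟨fun x hx => (h'.reg x hx).trans (h.reg x hx), fun a ha => (h'.arr a ha).trans (h.arr a ha)⟩

/-- Not writing to a location is checked on the syntax by a Boolean function, so for concrete
programs the preservation facts below reduce to `rfl`. Loop invariants then only need to mention
what actually changes. -/
theorem Exec.frame {p : Prog} {s s' : State} {t : ℕ} (h : Exec p s s' t) : p.Frame s s' := by
  induction h with
  | skip | while_false => exact Prog.Frame.refl _ _
  | const | copy | succ | pred | load =>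
    refine ⟨fun y hy => ?_, fun _ _ => rfl⟩
    simp only [Prog.KeepsReg, bne_iff_ne] at hy
    simp [hy.symm]
  | store =>
    refine ⟨fun _ _ => rfl, fun b hb => ?_⟩
    simp only [Prog.KeepsArr, bne_iff_ne] at hb
    simp [hb.symm]
  | seq _ _ ih ih' =>
    constructor
    · intro x hx
      simp only [Prog.KeepsReg, Bool.and_eq_true] at hx
      rw [ih'.reg x hx.2, ih.reg x hx.1]
    · intro a ha
      simp only [Prog.KeepsArr, Bool.and_eq_true] at ha
      rw [ih'.arr a ha.2, ih.arr a ha.1]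
  | ite_true _ _ ih =>
    constructor
    · intro x hx
      simp only [Prog.KeepsReg, Bool.and_eq_true] at hx
      exact ih.reg x hx.1
    · intro a ha
      simp only [Prog.KeepsArr, Bool.and_eq_true] at ha
      exact ih.arr a ha.1
  | ite_false _ _ ih =>
    constructor
    · intro x hx
      simp only [Prog.KeepsReg, Bool.and_eq_true] at hx
      exact ih.reg x hx.2
    · intro a ha
      simp only [Prog.KeepsArr, Bool.and_eq_true] at ha
      exact ih.arr a ha.2
  | while_true _ _ _ ih ih' =>
    exact Prog.Frame.trans ⟨ih.reg, ih.arr⟩ ih'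

/-- Started in state `s`, the program `p` halts within `T` steps in a state satisfying `Q`. -/
def Runs (p : Prog) (s : State) (Q : State → Prop) (T : ℕ) : Prop :=
  ∃ s' t, Exec p s s' t ∧ t ≤ T ∧ Q s'

namespace Runs

variable {p q : Prog} {s : State} {Q R : State → Prop} {T U : ℕ}

theorem mono (h : Runs p s Q T) (hQ : ∀ s', p.Frame s s' → Q s' → R s') (hT : T ≤ U) :
    Runs p s R U := by
  obtain ⟨s', t, h, ht, hs⟩ := h
  exact ⟨s', t, h, ht.trans hT, hQ s' h.frame hs⟩

theorem seq (h : Runs p s Q T) (h' : ∀ s', p.Frame s s' → Q s' → Runs q s' R U) :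
    Runs (p ;; q) s R (T + U) := by
  obtain ⟨s', t, h, ht, hs⟩ := h
  obtain ⟨s'', t', h', ht', hs'⟩ := h' s' h.frame hs
  exact ⟨s'', t + t', h.seq h', by omega, hs'⟩

theorem skip (h : Q s) : Runs .skip s Q (T + 1) := ⟨_, _, .skip s, by omega, h⟩

theorem const {x c : ℕ} (h : Q (s.setReg x c)) : Runs (.const x c) s Q (T + 1) :=
  ⟨_, _, .const x c s, by omega, h⟩

theorem copy {x y : ℕ} (h : Q (s.setReg x (s.reg y))) : Runs (.copy x y) s Q (T + 1) :=
  ⟨_, _, .copy x y s, by omega, h⟩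

theorem succ {x : ℕ} (h : Q (s.setReg x (s.reg x + 1))) : Runs (.succ x) s Q (T + 1) :=
  ⟨_, _, .succ x s, by omega, h⟩

theorem store {a i x : ℕ} (h : Q (s.setArr a (s.reg i) (s.reg x))) :
    Runs (.store a i x) s Q (T + 1) :=
  ⟨_, _, .store a i x s, by omega, h⟩

theorem load {x a i : ℕ} (h : Q (s.setReg x (s.arr a (s.reg i)))) :
    Runs (.load x a i) s Q (T + 1) :=
  ⟨_, _, .load x a i s, by omega, h⟩

theorem const_seq {x c : ℕ} (h : Runs q (s.setReg x c) Q T) :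
    Runs (.const x c ;; q) s Q (T + 1) := by
  obtain ⟨s', t, h, ht, hs⟩ := h
  exact ⟨s', _, (Exec.const x c s).seq h, by omega, hs⟩

theorem copy_seq {x y : ℕ} (h : Runs q (s.setReg x (s.reg y)) Q T) :
    Runs (.copy x y ;; q) s Q (T + 1) := by
  obtain ⟨s', t, h, ht, hs⟩ := h
  exact ⟨s', _, (Exec.copy x y s).seq h, by omega, hs⟩

theorem succ_seq {x : ℕ} (h : Runs q (s.setReg x (s.reg x + 1)) Q T) :
    Runs (.succ x ;; q) s Q (T + 1) := by
  obtain ⟨s', t, h, ht, hs⟩ := h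
  exact ⟨s', _, (Exec.succ x s).seq h, by omega, hs⟩

theorem pred_seq {x : ℕ} (h : Runs q (s.setReg x (s.reg x - 1)) Q T) :
    Runs (.pred x ;; q) s Q (T + 1) := by
  obtain ⟨s', t, h, ht, hs⟩ := h
  exact ⟨s', _, (Exec.pred x s).seq h, by omega, hs⟩

theorem load_seq {x a i : ℕ} (h : Runs q (s.setReg x (s.arr a (s.reg i))) Q T) :
    Runs (.load x a i ;; q) s Q (T + 1) := by
  obtain ⟨s', t, h, ht, hs⟩ := h
  exact ⟨s', _, (Exec.load x a i s).seq h, by omega, hs⟩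

theorem store_seq {a i x : ℕ} (h : Runs q (s.setArr a (s.reg i) (s.reg x)) Q T) :
    Runs (.store a i x ;; q) s Q (T + 1) := by
  obtain ⟨s', t, h, ht, hs⟩ := h
  exact ⟨s', _, (Exec.store a i x s).seq h, by omega, hs⟩

theorem ite {b : Test} (h : b.Holds s → Runs p s Q T) (h' : ¬ b.Holds s → Runs q s Q T) :
    Runs (.ite b p q) s Q (T + 1) := by
  by_cases hb : b.Holds s
  · obtain ⟨s', t, h, ht, hs⟩ := h hb
    exact ⟨s', _, .ite_true hb h, by omega, hs⟩
  · obtain ⟨s', t, h, ht, hs⟩ := h' hb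
    exact ⟨s', _, .ite_false hb h, by omega, hs⟩

/-- A loop with invariant `I`, started at index `M` and left at index `N`; `B` bounds the time. -/
theorem loop {b : Test} (I : ℕ → State → Prop) (c B : ℕ → ℕ) {M N : ℕ} (hMN : M ≤ N)
    (h0 : I M s)
    (hp : ∀ i s', M ≤ i → i < N → p.Frame s s' → I i s' → b.Holds s' ∧ Runs p s' (I (i + 1)) (c i))
    (hB : ∀ i, M ≤ i → i < N → B i + c i + 1 ≤ B (i + 1))
    (hN : ∀ s', I N s' → ¬ b.Holds s') :
    Runs (.while b p) s (I N) (B N - B M + 1) := by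
  -- `B` is a potential whose increments pay for the iterations. In the induction the starting state
  -- moves, so the hypothesis on the body is restated for frames from the current state. The bound
  -- `B M ≤ B N` is carried along because subtraction is truncated.
  suffices H : ∀ d M s', M + d = N → I M s' →
      (∀ i, M ≤ i → i < N → ∀ s'', p.Frame s' s'' → I i s'' →
        b.Holds s'' ∧ Runs p s'' (I (i + 1)) (c i)) →
      (∀ i, M ≤ i → i < N → B i + c i + 1 ≤ B (i + 1)) →
      B M ≤ B N ∧ Runs (.while b p) s' (I N) (B N - B M + 1) from
    (H (N - M) M s (by omega) h0 (fun i h h' s'' => hp i s'' h h') hB).2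
  intro d
  induction d with
  | zero =>
    intro M s' hM h0 _ _
    obtain rfl : M = N := by omega
    exact ⟨le_rfl, s', 1, .while_false (hN s' h0), by omega, h0⟩
  | succ d ih =>
    intro M s' hM h0 hp hB
    obtain ⟨hb, s₁, t, hex, ht, h1⟩ := hp M le_rfl (by omega) s' (Prog.Frame.refl _ _) h0
    obtain ⟨hle, s₂, t', hex', ht', h2⟩ := ih (M + 1) s₁ (by omega) h1
      (fun i h h' s'' hf => hp i (by omega) h' s'' (hex.frame.trans hf))
      (fun i h h' => hB i (by omega) h')
    have := hB M le_rfl (by omega)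
    exact ⟨by omega, s₂, _, .while_true hb hex hex', by omega, h2⟩

end Runs

/-- `for x from the current value of x up to (excluding) y do p`. -/
def Prog.upTo (x y : ℕ) (p : Prog) : Prog := .while (.lt x y) (p ;; .succ x)

/-- The counter advances only after the body, so the body must establish the next invariant for the
state with `x` already updated. The `2` in `hB` pays for the test and the increment. -/
theorem Runs.upTo {x y : ℕ} {p : Prog} {s : State} (I : ℕ → State → Prop) (c B : ℕ → ℕ) {M N : ℕ}
    (hMN : M ≤ N) (hx : s.reg x = M) (hy : s.reg y = N) (h0 : I M s)
    (hxy : x ≠ y) (hpx : p.KeepsReg x = true) (hpy : p.KeepsReg y = true)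
    (hp : ∀ i s', M ≤ i → i < N → (Prog.upTo x y p).Frame s s' → s'.reg x = i → I i s' →
      Runs p s' (fun s'' => I (i + 1) (s''.setReg x (i + 1))) (c i))
    (hB : ∀ i, M ≤ i → i < N → B i + c i + 2 ≤ B (i + 1)) :
    Runs (Prog.upTo x y p) s (I N) (B N - B M + 1) := by
  have hy' : (p ;; .succ x).KeepsReg y = true := by simp [Prog.KeepsReg, hpy, hxy]
  refine Runs.mono (Runs.loop (fun i s' => s'.reg x = i ∧ s'.reg y = N ∧ I i s')
    (fun i => c i + 1) B hMN ⟨hx, hy, h0⟩ ?_ (fun i h h' => by have := hB i h h'; omega) ?_)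
    (fun s' _ h => h.2.2) le_rfl
  · rintro i s' h h' hf ⟨hix, hiy, hI⟩
    refine ⟨by simp only [Test.Holds]; omega, ?_⟩
    refine Runs.seq (hp i s' h h' ⟨hf.reg, hf.arr⟩ hix hI) fun s'' hf' h2 =>
      Runs.succ (T := 0) ?_
    have e := hf'.reg x hpx
    have e' := hf'.reg y hpy
    rw [e, hix]
    exact ⟨by simp, by simp [hxy.symm, e', hiy], h2⟩
  · rintro s' ⟨h1, h2, -⟩
    simp [Test.Holds, h1, h2]

/-- The case of iterations of constant cost. -/
theorem Runs.upTo_const {x y : ℕ} {p : Prog} {s : State} (I : ℕ → State → Prop) (c : ℕ) {M N : ℕ}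
    (hMN : M ≤ N) (hx : s.reg x = M) (hy : s.reg y = N) (h0 : I M s)
    (hxy : x ≠ y) (hpx : p.KeepsReg x = true) (hpy : p.KeepsReg y = true)
    (hp : ∀ i s', M ≤ i → i < N → (Prog.upTo x y p).Frame s s' → s'.reg x = i → I i s' →
      Runs p s' (fun s'' => I (i + 1) (s''.setReg x (i + 1))) c) :
    Runs (Prog.upTo x y p) s (I N) ((c + 2) * (N - M) + 1) := by
  refine Runs.mono (Runs.upTo I (fun _ => c) (fun i => (c + 2) * i) hMN hx hy h0 hxy hpx hpy hp
    (fun i _ _ => by ring_nf; omega)) (fun _ _ h => h) ?_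
  rw [Nat.mul_sub]

/-- The number of indices `j` with `lo ≤ j < hi` and `g j = c`. -/
def fiberCount (g : ℕ → ℕ) (lo hi c : ℕ) : ℕ := {j ∈ Finset.Ico lo hi | g j = c}.card

theorem fiberCount_self (g : ℕ → ℕ) (lo c : ℕ) : fiberCount g lo lo c = 0 := by
  simp [fiberCount]

theorem fiberCount_succ (g : ℕ → ℕ) {lo hi : ℕ} (h : lo ≤ hi) (c : ℕ) :
    fiberCount g lo (hi + 1) c = fiberCount g lo hi c + if c = g hi then 1 else 0 := by
  unfold fiberCount
  rw [← Finset.insert_Ico_right_eq_Ico_add_one h, Finset.filter_insert]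
  by_cases hc : g hi = c
  · rw [if_pos hc, if_pos hc.symm, Finset.card_insert_of_notMem (by simp)]
  · rw [if_neg hc, if_neg (Ne.symm hc), add_zero]

theorem fiberCount_eq_zero {g : ℕ → ℕ} {lo hi c : ℕ} :
    fiberCount g lo hi c = 0 ↔ ∀ j, lo ≤ j → j < hi → g j ≠ c := by
  simp [fiberCount, Finset.filter_eq_empty_iff]

/-! ### The graph in memory -/

/-- Adjacency lists, in the format of `Encodes`, of a graph on `0, …, n-1` with adjacency relation
`A`, and a map `col` of the vertices onto a set of numbers that contains `1, …, k` and at most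
`0` besides. -/
structure Input (n k : ℕ) (A : ℕ → ℕ → Prop) (off adj col : ℕ → ℕ) : Prop where
  irrefl : ∀ v, ¬ A v v
  off_le : ∀ v < n, off v ≤ off (v + 1)
  adj : ∀ v < n, Set.BijOn adj (Set.Ico (off v) (off (v + 1))) {w | w < n ∧ A v w}
  col_le : ∀ v < n, col v ≤ k
  surj : ∀ c, 1 ≤ c → c ≤ k → ∃ w < n, col w = c

/-- The memory holds the input, and register `2` holds `0`. -/
structure Memory (n k : ℕ) (off adj col : ℕ → ℕ) (s : State) : Prop where
  n : s.reg 0 = n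
  k : s.reg 1 = k
  zero : s.reg 2 = 0
  off : s.arr 0 = off
  adj : s.arr 1 = adj
  col : s.arr 2 = col

/-- The program never writes to the registers and arrays that hold the input. -/
def Prog.KeepsInput (p : Prog) : Bool :=
  p.KeepsReg 0 && p.KeepsReg 1 && p.KeepsReg 2 && p.KeepsArr 0 && p.KeepsArr 1 && p.KeepsArr 2

theorem Memory.frame {n k : ℕ} {off adj col : ℕ → ℕ} {s s' : State} {p : Prog}
    (h : Memory n k off adj col s) (hf : p.Frame s s') (hp : p.KeepsInput = true) :
    Memory n k off adj col s' := by
  simp only [Prog.KeepsInput, Bool.and_eq_true] at hp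
  obtain ⟨⟨⟨⟨⟨h0, h1⟩, h2⟩, a0⟩, a1⟩, a2⟩ := hp
  exact ⟨(hf.reg _ h0).trans h.n, (hf.reg _ h1).trans h.k, (hf.reg _ h2).trans h.zero,
    (hf.arr _ a0).trans h.off, (hf.arr _ a1).trans h.adj, (hf.arr _ a2).trans h.col⟩

/-! ### Counting -/

/-- Registers `4` and `5` become the bounds of the adjacency list of the vertex in register `x`. -/
def Prog.edges (x : ℕ) : Prog := .load 4 0 x ;; .copy 5 x ;; .succ 5 ;; .load 5 0 5

theorem runs_edges {x v : ℕ} {off : ℕ → ℕ} {s : State} (hx : s.reg x = v) (hx4 : x ≠ 4)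
    (ho : s.arr 0 = off) :
    Runs (.edges x) s (fun s' => s'.reg 4 = off v ∧ s'.reg 5 = off (v + 1)) 4 :=
  Runs.load_seq (Runs.copy_seq (Runs.succ_seq (Runs.load (T := 0) (by simp [hx4, hx, ho]))))

/-- Array `6` counts, for each class, the neighbors in it of the vertex whose adjacency list
is bounded by registers `4` and `5`. -/
def Prog.countNeighbors : Prog :=
  .upTo 4 5 (.load 6 1 4 ;; .load 7 2 6 ;; .load 8 6 7 ;; .succ 8 ;; .store 6 7 8)

theorem runs_countNeighbors {adj col : ℕ → ℕ} {lo hi : ℕ} {s : State} (hle : lo ≤ hi)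
    (h4 : s.reg 4 = lo) (h5 : s.reg 5 = hi) (ha : s.arr 1 = adj) (hc : s.arr 2 = col)
    (h6 : s.arr 6 = fun _ => 0) :
    Runs .countNeighbors s (fun s' => s'.arr 6 = fiberCount (fun j => col (adj j)) lo hi)
      (7 * (hi - lo) + 1) := by
  refine Runs.upTo_const
    (fun i s' => s'.arr 6 = fiberCount (fun j => col (adj j)) lo i) 5 hle h4 h5
    (by rw [h6]; funext c; exact (fiberCount_self _ _ _).symm) (by decide) rfl rfl
    fun i s' hi _ hf hr hI => ?_
  refine Runs.load_seq (Runs.load_seq (Runs.load_seq (Runs.succ_seq (Runs.store (T := 0) ?_))))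
  have ha' := (hf.arr 1 rfl).trans ha
  have hc' := (hf.arr 2 rfl).trans hc
  funext c
  rw [fiberCount_succ _ hi]
  simp only [State.setReg_arr, State.setArr_arr, State.setReg_reg, hr, ha', hc', hI]
  by_cases h : c = col (adj i) <;> simp [h]

/-- Undo the effect of `Prog.countNeighbors` on array `6`. -/
def Prog.clearCounts : Prog := .upTo 4 5 (.load 6 1 4 ;; .load 7 2 6 ;; .store 6 7 2)

theorem runs_clearCounts {adj col : ℕ → ℕ} {lo hi : ℕ} {s : State} (hle : lo ≤ hi)
    (h2 : s.reg 2 = 0) (h4 : s.reg 4 = lo) (h5 : s.reg 5 = hi) (ha : s.arr 1 = adj)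
    (hc : s.arr 2 = col) (h6 : s.arr 6 = fiberCount (fun j => col (adj j)) lo hi) :
    Runs .clearCounts s (fun s' => s'.arr 6 = fun _ => 0) (5 * (hi - lo) + 1) := by
  refine Runs.mono (Runs.upTo_const
    -- Any class whose count is still nonzero occurs in the unread part of the list; at the end this
    -- part is empty.
    (fun i s' => ∀ c, s'.arr 6 c ≠ 0 → ∃ j, i ≤ j ∧ j < hi ∧ col (adj j) = c) 3 hle h4 h5
    (fun c h => ?_) (by decide) rfl rfl fun i s' hi _ hf hr hI => ?_) ?_ le_rfl
  · rw [h6, Ne, fiberCount_eq_zero] at h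
    push Not at h
    exact h
  · refine Runs.load_seq (Runs.load_seq (Runs.store (T := 0) ?_))
    have ha' := (hf.arr 1 rfl).trans ha
    have hc' := (hf.arr 2 rfl).trans hc
    have h2' := (hf.reg 2 rfl).trans h2
    intro c h
    by_cases hcc : c = col (adj i)
    · simp [hr, ha', hc', h2', hcc] at h
    · simp [hr, ha', hc', hcc] at h
      obtain ⟨j, h1, h2, h3⟩ := hI c h
      refine ⟨j, ?_, h2, h3⟩
      rcases h1.eq_or_lt with rfl | h1
      · exact absurd h3.symm hcc
      · exact h1
  · intro s' _ h
    funext c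
    by_contra hne
    obtain ⟨j, h1, h2, -⟩ := h c hne
    omega

/-- Array `5` counts the vertices in each class. -/
def Prog.countClasses : Prog :=
  .const 3 0 ;; .upTo 3 0 (.load 7 2 3 ;; .load 8 5 7 ;; .succ 8 ;; .store 5 7 8)

theorem runs_countClasses {n k : ℕ} {off adj col : ℕ → ℕ} {s : State}
    (hm : Memory n k off adj col s) (h5 : s.arr 5 = fun _ => 0) :
    Runs .countClasses s (fun s' => s'.arr 5 = fiberCount col 0 n) (6 * n + 2) := by
  refine Runs.const_seq ?_
  refine Runs.upTo_const (fun i s' => s'.arr 5 = fiberCount col 0 i) 4 (Nat.zero_le n) (by simp)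
    (by simpa using hm.n)
    (by simp only [State.setReg_arr, h5]; funext c; exact (fiberCount_self _ _ _).symm)
    (by decide) rfl rfl fun i s' _ _ hf hr hI => ?_
  refine Runs.load_seq (Runs.load_seq (Runs.succ_seq (Runs.store (T := 0) ?_)))
  have hc' : s'.arr 2 = col := (hf.arr 2 rfl).trans hm.col
  funext c
  rw [fiberCount_succ _ (Nat.zero_le i)]
  simp only [State.setReg_arr, State.setArr_arr, State.setReg_reg, hr, hc', hI]
  by_cases h : c = col i <;> simp [h]

/-! ### Finding, for each vertex of the center, a class that it can join -/

/-- What is to be found for a vertex `v` of class `0`: a class `c ≠ 0` that is `R`-related to `v`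
throughout, or `c = 0` if there is none. -/
structure IsHost (n k : ℕ) (col : ℕ → ℕ) (R : ℕ → ℕ → Prop) (v c : ℕ) : Prop where
  le : c ≤ k
  rel : c ≠ 0 → ∀ w < n, col w = c → R v w
  none : c = 0 → ∀ d, 1 ≤ d → d ≤ k → ∃ w < n, col w = d ∧ ¬ R v w

/-- Register `10` becomes a class all of whose vertices are in the list bounded by registers
`4` and `5`, if there is one. -/
def Prog.fullClass : Prog :=
  .upTo 4 5 (.load 6 1 4 ;; .load 7 2 6 ;; .load 8 6 7 ;; .load 9 5 7 ;;
    .ite (.eq 8 9) (.copy 10 7) .skip)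

/-- The list has no repetitions, so the left side counts the neighbors of `v` in the class. They
form a subset of the class, which is all of it exactly when the cardinalities agree. -/
theorem Input.fiberCount_eq_iff {n k : ℕ} {A : ℕ → ℕ → Prop} {off adj col : ℕ → ℕ}
    (h : Input n k A off adj col) {v : ℕ} (hv : v < n) (c : ℕ) :
    fiberCount (fun j => col (adj j)) (off v) (off (v + 1)) c = fiberCount col 0 n c ↔
      ∀ w < n, col w = c → A v w := by
  have hb := h.adj v hv
  set S := {j ∈ Finset.Ico (off v) (off (v + 1)) | col (adj j) = c} with hS
  have hinj : Set.InjOn adj S := hb.injOn.mono fun j hj => by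
    simp only [hS, Finset.coe_filter, Finset.mem_Ico, Set.mem_ofPred_eq] at hj
    exact hj.1
  have hsub : S.image adj ⊆ {w ∈ Finset.Ico 0 n | col w = c} := by
    intro w hw
    obtain ⟨j, hj, rfl⟩ := Finset.mem_image.1 hw
    simp only [hS, Finset.mem_filter, Finset.mem_Ico] at hj
    simpa [hj.2] using (hb.mapsTo hj.1).1
  have hcard : fiberCount (fun j => col (adj j)) (off v) (off (v + 1)) c = (S.image adj).card :=
    (Finset.card_image_of_injOn hinj).symm
  rw [hcard]
  constructor
  · intro he w hw hwc
    have : w ∈ S.image adj := by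
      rw [Finset.eq_of_subset_of_card_le hsub he.ge]
      simp [hw, hwc]
    obtain ⟨j, hj, rfl⟩ := Finset.mem_image.1 this
    simp only [hS, Finset.mem_filter, Finset.mem_Ico] at hj
    exact (hb.mapsTo hj.1).2
  · intro ha
    refine congrArg Finset.card (hsub.antisymm fun w hw => ?_)
    simp only [Finset.mem_filter, Finset.mem_Ico, Nat.zero_le, true_and] at hw
    obtain ⟨j, hj, rfl⟩ := hb.surjOn ⟨hw.1, ha w hw.1 hw.2⟩
    exact Finset.mem_image_of_mem _ (by simpa [hS, hw.2] using hj)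

/-- `p` finds a host of the vertex in register `3`, if this vertex is in class `0`, and returns it
in register `10`. -/
structure Prog.FindsHost (p : Prog) (R : (ℕ → ℕ → Prop) → ℕ → ℕ → Prop) : Prop where
  keepsInput : p.KeepsInput = true
  keepsReg : p.KeepsReg 3 = true
  keepsArr : ∀ a, p.KeepsArr a = true
  runs : ∀ {n k : ℕ} {A : ℕ → ℕ → Prop} {off adj col : ℕ → ℕ} {s : State} {v : ℕ},
    Input n k A off adj col → Memory n k off adj col s → v < n → col v = 0 → s.reg 3 = v →
    s.reg 4 = off v → s.reg 5 = off (v + 1) → s.reg 10 = 0 → s.arr 5 = fiberCount col 0 n →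
    s.arr 6 = fiberCount (fun j => col (adj j)) (off v) (off (v + 1)) →
    Runs p s (fun s' => IsHost n k col (R A) v (s'.reg 10)) (8 * (off (v + 1) - off v) + 8)

theorem findsHost_fullClass : Prog.fullClass.FindsHost fun A => A where
  keepsInput := rfl
  keepsReg := rfl
  keepsArr _ := rfl
  runs {n k A off adj col s v} h hm hv hcv h3 h4 h5 h10 ha5 ha6 := by
    have hfull := h.fiberCount_eq_iff hv
    refine Runs.mono (Runs.upTo_const (fun i s' => s'.reg 10 ≤ k ∧
      (s'.reg 10 ≠ 0 → ∀ w < n, col w = s'.reg 10 → A v w) ∧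
      (s'.reg 10 = 0 → ∀ j, off v ≤ j → j < i → ¬ ∀ w < n, col w = col (adj j) → A v w))
      6 (h.off_le v hv) h4 h5 ⟨by simp [h10], by simp [h10], fun _ j _ _ => by omega⟩
      (by decide) rfl rfl fun i s' hi hi' hf hr hI => ?_) ?_ (by omega)
    · refine Runs.load_seq (Runs.load_seq (Runs.load_seq (Runs.load_seq (Runs.ite (T := 1) ?_ ?_))))
      all_goals
        have e1 := (hf.arr 1 rfl).trans hm.adj
        have e2 := (hf.arr 2 rfl).trans hm.col
        have e5 := (hf.arr 5 rfl).trans ha5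
        have e6 := (hf.arr 6 rfl).trans ha6
        simp only [Test.Holds, State.setReg_arr, State.setReg_reg, hr, e1, e2, e5, e6]
        intro hb
        simp [hfull] at hb
      · refine Runs.copy (T := 0) ?_
        -- Class `0` contains `v`, which is not its own neighbor, so it is never full. Hence `0` in
        -- register `10` unambiguously means that nothing was found.
        have hne : col (adj i) ≠ 0 := fun h0 => h.irrefl v (hb v hv (by rw [h0, hcv]))
        simpa [hr, e1, e2, hne] using
          ⟨h.col_le _ ((h.adj v hv).mapsTo ⟨hi, hi'⟩).1, hb⟩
      · refine Runs.skip (T := 0) ?_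
        obtain ⟨h1, h2, h3⟩ := hI
        refine ⟨by simpa using h1, by simpa using h2, fun h0 j hj hj' => ?_⟩
        rcases Nat.lt_succ_iff_lt_or_eq.1 hj' with hj' | rfl
        · exact h3 (by simpa using h0) j hj hj'
        · push Not
          simpa using hb
    · rintro s' - ⟨h1, h2, h3⟩
      refine ⟨h1, h2, fun h0 d hd hdk => ?_⟩
      by_contra hcon
      push Not at hcon
      -- A full class is nonempty, so one of its vertices is in the list and the loop has inspected
      -- the class.
      obtain ⟨w, hw, rfl⟩ := h.surj d hd hdk
      obtain ⟨j, hj, rfl⟩ := (h.adj v hv).surjOn ⟨hw, hcon w hw rfl⟩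
      exact h3 h0 j hj.1 hj.2 hcon

/-- Register `10` becomes a class with no vertex in the list bounded by registers `4` and `5`,
if there is one. -/
def Prog.missedClass : Prog :=
  .const 7 1 ;; .load 8 6 7 ;; .while (.lt 2 8) (.succ 7 ;; .load 8 6 7) ;;
    .ite (.lt 1 7) .skip (.copy 10 7)

/-- Pigeonhole: `hi - lo` indices cannot take all of the `hi - lo + 1` values `1, …, hi - lo + 1`.
-/
theorem exists_fiberCount_eq_zero (g : ℕ → ℕ) (lo hi : ℕ) :
    ∃ N, N ≤ hi - lo ∧ fiberCount g lo hi (N + 1) = 0 ∧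
      ∀ i < N, fiberCount g lo hi (i + 1) ≠ 0 := by
  classical
  have hex : ∃ N, N ≤ hi - lo ∧ fiberCount g lo hi (N + 1) = 0 := by
    by_contra! hcon
    have hsub : Finset.Icc 1 (hi - lo + 1) ⊆ (Finset.Ico lo hi).image g := by
      intro c hc
      rw [Finset.mem_Icc] at hc
      have := hcon (c - 1) (by omega)
      rw [Nat.sub_add_cancel hc.1, Ne, fiberCount_eq_zero] at this
      push Not at this
      obtain ⟨j, h1, h2, h3⟩ := this
      exact Finset.mem_image.2 ⟨j, Finset.mem_Ico.2 ⟨h1, h2⟩, h3⟩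
    have := (Finset.card_le_card hsub).trans Finset.card_image_le
    simp at this
  refine ⟨Nat.find hex, (Nat.find_spec hex).1, (Nat.find_spec hex).2, fun i hi h0 => ?_⟩
  have := (Nat.find_spec hex).1
  exact Nat.find_min hex hi ⟨by omega, h0⟩

theorem findsHost_missedClass : Prog.missedClass.FindsHost fun A v w => ¬ A v w where
  keepsInput := rfl
  keepsReg := rfl
  keepsArr _ := rfl
  runs {n k A off adj col s v} h hm hv hcv h3 h4 h5 h10 ha5 ha6 := by
    set cnt := fiberCount (fun j => col (adj j)) (off v) (off (v + 1)) with hcnt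
    have hzero : ∀ c, cnt c = 0 ↔ ∀ w < n, col w = c → ¬ A v w := by
      intro c
      rw [hcnt, fiberCount_eq_zero]
      constructor
      · rintro hj w hw hc ha
        obtain ⟨j, hj', rfl⟩ := (h.adj v hv).surjOn ⟨hw, ha⟩
        exact hj j hj'.1 hj'.2 hc
      · intro hw j hj hj' hc
        obtain ⟨h1, h2⟩ := (h.adj v hv).mapsTo ⟨hj, hj'⟩
        exact hw _ h1 hc h2
    obtain ⟨N, hN, hN0, hlt⟩ :=
      exists_fiberCount_eq_zero (fun j => col (adj j)) (off v) (off (v + 1))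
    refine Runs.mono (T := (3 * N - 3 * 0 + 1 + 2) + 1 + 1) ?_ (fun _ _ h => h) (by omega)
    refine Runs.const_seq (Runs.load_seq ?_)
    refine Runs.seq (T := 3 * N - 3 * 0 + 1) (U := 2) (Runs.loop (M := 0) (N := N)
      (fun i s' => s'.reg 7 = i + 1 ∧ s'.reg 8 = cnt (i + 1))
      (fun _ => 2) (fun i => 3 * i) (Nat.zero_le _) ?_ ?_ (fun i _ _ => by omega) ?_) ?_
    · simp [ha6]
    · rintro i s' - hi hf ⟨h7, h8⟩
      have e2 : s'.reg 2 = 0 := (hf.reg 2 rfl).trans (by simpa using hm.zero)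
      have e6 : s'.arr 6 = cnt := (hf.arr 6 rfl).trans (by simpa using ha6)
      refine ⟨?_, Runs.succ_seq (Runs.load (T := 0) (by simp [h7, e6]))⟩
      simp only [Test.Holds, e2, h8]
      exact Nat.pos_of_ne_zero (hlt i hi)
    · rintro s' ⟨h7, h8⟩
      simp only [Test.Holds, h8, hcnt, hN0]
      omega
    · rintro s' hf ⟨h7, h8⟩
      have e1 : s'.reg 1 = k := (hf.reg 1 rfl).trans (by simpa using hm.k)
      have e10 : s'.reg 10 = 0 := (hf.reg 10 rfl).trans (by simpa using h10)
      -- The search ignores the bound `k`. If it stops beyond `k`, every class `1, …, k` has a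
      -- positive count, so there is no host and register `10` stays `0`.
      refine Runs.ite (T := 1) ?_ ?_ <;> simp only [Test.Holds, e1, h7] <;> intro hk
      · refine Runs.skip (T := 0) ?_
        rw [e10]
        refine ⟨by omega, by simp, fun _ d hd hdk => ?_⟩
        have := hlt (d - 1) (by omega)
        rw [Nat.sub_add_cancel hd, ← hcnt, Ne, hzero] at this
        push Not at this
        simpa using this
      · refine Runs.copy (T := 0) ?_
        simp only [State.setReg_reg, h7, if_true]
        exact ⟨by omega, fun _ => (hzero _).1 hN0, by omega⟩

/-- Array `4` becomes the map that sends a vertex of class `0` to a host found by `p`, and every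
other vertex to its class. -/
def Prog.findHosts (p : Prog) : Prog :=
  .const 3 0 ;; .upTo 3 0 (.load 7 2 3 ;;
    .ite (.eq 7 2)
      (.edges 3 ;; .countNeighbors ;; .edges 3 ;; .const 10 0 ;; p ;; .edges 3 ;; .clearCounts)
      (.copy 10 7) ;;
    .store 4 3 10)

/-- The map `f` sends vertices of class `0` to hosts, and the others to their classes. -/
structure IsHostMap (n k : ℕ) (col : ℕ → ℕ) (R : ℕ → ℕ → Prop) (f : ℕ → ℕ) : Prop where
  eq_col : ∀ v < n, col v ≠ 0 → f v = col v
  isHost : ∀ v < n, col v = 0 → IsHost n k col R v (f v)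

/-- Erasing the counts by a second pass over the list, rather than over all classes, keeps the cost
proportional to the degree and leaves array `6` ready for the next vertex. The list bounds are
reloaded because the loops advance register `4`. -/
theorem runs_findHost {p : Prog} {R : (ℕ → ℕ → Prop) → ℕ → ℕ → Prop} (hp : p.FindsHost R)
    {n k : ℕ} {A : ℕ → ℕ → Prop} {off adj col : ℕ → ℕ} {s : State} {v : ℕ}
    (h : Input n k A off adj col) (hm : Memory n k off adj col s) (hv : v < n) (hcv : col v = 0)
    (h3 : s.reg 3 = v) (h5 : s.arr 5 = fiberCount col 0 n) (h6 : s.arr 6 = fun _ => 0) :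
    Runs (.edges 3 ;; .countNeighbors ;; .edges 3 ;; .const 10 0 ;; p ;; .edges 3 ;; .clearCounts)
      s (fun s' => IsHost n k col (R A) v (s'.reg 10) ∧ s'.arr 6 = fun _ => 0)
      (20 * (off (v + 1) - off v) + 23) := by
  have hle := h.off_le v hv
  have hpi := hp.keepsInput
  simp only [Prog.KeepsInput, Bool.and_eq_true] at hpi
  set d := off (v + 1) - off v
  refine Runs.mono (T := 4 + ((7 * d + 1) + (4 + ((8 * d + 8 + (4 + (5 * d + 1))) + 1)))) ?_
    (fun _ _ h => h) (by omega)
  refine Runs.seq (runs_edges h3 (by decide) hm.off) fun s₁ f₁ ⟨h4₁, h5₁⟩ => ?_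
  have m₁ := hm.frame f₁ rfl
  have h3₁ := (f₁.reg 3 rfl).trans h3
  refine Runs.seq (runs_countNeighbors hle h4₁ h5₁ m₁.adj m₁.col ((f₁.arr 6 rfl).trans h6))
    fun s₂ f₂ h6₂ => ?_
  have m₂ := m₁.frame f₂ rfl
  have h3₂ := (f₂.reg 3 rfl).trans h3₁
  refine Runs.seq (runs_edges h3₂ (by decide) m₂.off) fun s₃ f₃ ⟨h4₃, h5₃⟩ => ?_
  have m₃ := m₂.frame f₃ rfl
  have h3₃ := (f₃.reg 3 rfl).trans h3₂
  have a6₃ := (f₃.arr 6 rfl).trans h6₂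
  have a5₃ := (f₃.arr 5 rfl).trans ((f₂.arr 5 rfl).trans ((f₁.arr 5 rfl).trans h5))
  refine Runs.const_seq ?_
  have m₄ : Memory n k off adj col (s₃.setReg 10 0) :=
    ⟨by simp [m₃.n], by simp [m₃.k], by simp [m₃.zero], m₃.off, m₃.adj, m₃.col⟩
  refine Runs.seq (hp.runs h m₄ hv hcv (by simp [h3₃]) (by simp [h4₃]) (by simp [h5₃]) (by simp)
    a5₃ a6₃) fun s₅ f₅ host => ?_
  have m₅ := m₄.frame f₅ hp.keepsInput
  have h3₅ : s₅.reg 3 = v := (f₅.reg 3 hp.keepsReg).trans (by simp [h3₃])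
  refine Runs.seq (runs_edges h3₅ (by decide) m₅.off) fun s₆ f₆ ⟨h4₆, h5₆⟩ => ?_
  have m₆ := m₅.frame f₆ rfl
  refine Runs.mono (runs_clearCounts hle m₆.zero h4₆ h5₆ m₆.adj m₆.col
    ((f₆.arr 6 rfl).trans ((f₅.arr 6 (hp.keepsArr 6)).trans a6₃))) (fun s' f h => ⟨?_, h⟩) le_rfl
  rw [f.reg 10 rfl, f₆.reg 10 rfl]
  exact host

theorem keepsInput_findHosts {p : Prog} {R : (ℕ → ℕ → Prop) → ℕ → ℕ → Prop} (hp : p.FindsHost R) :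
    (Prog.findHosts p).KeepsInput = true := by
  have hpi := hp.keepsInput
  simp only [Prog.KeepsInput, Bool.and_eq_true] at hpi
  simp [Prog.KeepsInput, Prog.findHosts, Prog.upTo, Prog.KeepsReg, Prog.KeepsArr, Prog.edges,
    Prog.countNeighbors, Prog.clearCounts, hpi]

theorem keepsArr_findHosts {p : Prog} {R : (ℕ → ℕ → Prop) → ℕ → ℕ → Prop} (hp : p.FindsHost R)
    {a : ℕ} (h4 : a ≠ 4) (h6 : a ≠ 6) : (Prog.findHosts p).KeepsArr a = true := by
  simp [Prog.findHosts, Prog.upTo, Prog.KeepsArr, Prog.edges, Prog.countNeighbors,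
    Prog.clearCounts, hp.keepsArr, h4.symm, h6.symm]

theorem runs_findHosts {p : Prog} {R : (ℕ → ℕ → Prop) → ℕ → ℕ → Prop} (hp : p.FindsHost R)
    {n k : ℕ} {A : ℕ → ℕ → Prop} {off adj col : ℕ → ℕ} {s : State}
    (h : Input n k A off adj col) (hm : Memory n k off adj col s)
    (h5 : s.arr 5 = fiberCount col 0 n) (h6 : s.arr 6 = fun _ => 0) :
    Runs (.findHosts p) s (fun s' => IsHostMap n k col (R A) (s'.arr 4))
      (20 * off n + 28 * n + 2) := by
  have hpi := hp.keepsInput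
  simp only [Prog.KeepsInput, Bool.and_eq_true] at hpi
  have h3p := hp.keepsReg
  have hpa := hp.keepsArr
  refine Runs.mono (T := (20 * off n + 28 * n - (20 * off 0 + 28 * 0) + 1) + 1) ?_
    (fun _ _ h => h) (by omega)
  refine Runs.const_seq (Runs.mono (Runs.upTo
    (fun i s' => s'.arr 6 = (fun _ => 0) ∧ ∀ v < i, (col v ≠ 0 → s'.arr 4 v = col v) ∧
      (col v = 0 → IsHost n k col (R A) v (s'.arr 4 v)))
    -- The potential telescopes over the list lengths, turning costs per degree into a bound linear
    -- in `off n`.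
    (fun v => 20 * (off (v + 1) - off v) + 26) (fun v => 20 * off v + 28 * v) (Nat.zero_le n)
    (by simp) (by simp [hm.n]) ⟨by simpa using h6, by simp⟩ (by decide) ?_ ?_
    (fun v s' _ hv hf hr hI => ?_) fun v _ hv => ?_)
    (fun s' _ hI => ⟨fun v hv => (hI.2 v hv).1, fun v hv => (hI.2 v hv).2⟩) le_rfl)
  · simp [Prog.KeepsReg, Prog.upTo, Prog.edges, Prog.countNeighbors, Prog.clearCounts, h3p]
  · simp [Prog.KeepsReg, Prog.upTo, Prog.edges, Prog.countNeighbors, Prog.clearCounts, hpi]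
  · have m0 : Memory n k off adj col (s.setReg 3 0) :=
      ⟨by simp [hm.n], by simp [hm.k], by simp [hm.zero], hm.off, hm.adj, hm.col⟩
    have m1 : Memory n k off adj col s' := by
      refine m0.frame hf ?_
      simp [Prog.KeepsInput, Prog.upTo, Prog.KeepsReg, Prog.KeepsArr, Prog.edges,
        Prog.countNeighbors, Prog.clearCounts, hpi]
    have a5 : s'.arr 5 = fiberCount col 0 n := by
      refine (hf.arr 5 ?_).trans h5
      simp [Prog.upTo, Prog.KeepsArr, Prog.edges, Prog.countNeighbors, Prog.clearCounts, hpa]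
    obtain ⟨a6, hI⟩ := hI
    refine Runs.load_seq ?_
    set s₁ := s'.setReg 7 (s'.arr 2 (s'.reg 3)) with hs₁
    have m₁ : Memory n k off adj col s₁ :=
      ⟨by simp [hs₁, m1.n], by simp [hs₁, m1.k], by simp [hs₁, m1.zero], m1.off, m1.adj, m1.col⟩
    have h7 : s₁.reg 7 = col v := by simp [hs₁, hr, m1.col]
    have h3 : s₁.reg 3 = v := by simp [hs₁, hr]
    refine Runs.seq (Q := fun s₂ => s₂.reg 3 = v ∧ s₂.arr 4 = s'.arr 4 ∧ s₂.arr 6 = (fun _ => 0) ∧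
      (col v ≠ 0 → s₂.reg 10 = col v) ∧ (col v = 0 → IsHost n k col (R A) v (s₂.reg 10)))
      (T := 20 * (off (v + 1) - off v) + 23 + 1) (U := 1)
      (Runs.ite ?_ ?_) ?_
    · intro hb
      simp only [Test.Holds, h7, m₁.zero] at hb
      refine Runs.mono (runs_findHost hp h m₁ hv hb h3 a5 a6)
        (fun s₂ f h => ⟨(f.reg 3 ?_).trans h3, (f.arr 4 ?_).trans rfl, h.2, by simp [hb],
          fun _ => h.1⟩) le_rfl
      · simp [Prog.KeepsReg, Prog.upTo, Prog.edges, Prog.countNeighbors, Prog.clearCounts, h3p]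
      · simp [Prog.upTo, Prog.KeepsArr, Prog.edges, Prog.countNeighbors, Prog.clearCounts, hpa]
    · intro hb
      simp only [Test.Holds, h7, m₁.zero] at hb
      exact Runs.copy ⟨by simp [h3], rfl, a6, by simp [h7], by simp [hb]⟩
    · rintro s₂ - ⟨e3, e4, e6, h1, h2⟩
      refine Runs.store (T := 0) ⟨by simpa using e6, fun u hu => ?_⟩
      simp only [State.setReg_arr, State.setArr_arr, e3, e4, if_true, Function.update_apply]
      by_cases huv : u = v
      · subst huv
        simpa using ⟨h1, h2⟩
      · simpa [huv] using hI u (by omega)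
  · have := h.off_le v hv
    omega

/-! ### Output -/

/-- Register `11` becomes a vertex without a host, or `n` if there is none. -/
def Prog.findFree : Prog :=
  .copy 11 0 ;; .const 3 0 ;; .upTo 3 0 (.load 8 4 3 ;; .ite (.eq 8 2) (.copy 11 3) .skip)

theorem runs_findFree {n k : ℕ} {off adj col f : ℕ → ℕ} {s : State}
    (hm : Memory n k off adj col s) (h4 : s.arr 4 = f) :
    Runs .findFree s (fun s' => (s'.reg 11 = n ∧ ∀ v < n, f v ≠ 0) ∨
      (s'.reg 11 < n ∧ f (s'.reg 11) = 0)) (5 * n + 3) := by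
  refine Runs.copy_seq (Runs.const_seq ?_)
  refine Runs.upTo_const (fun i s' => (s'.reg 11 = n ∧ ∀ v < i, f v ≠ 0) ∨
    (s'.reg 11 < n ∧ f (s'.reg 11) = 0)) 3 (Nat.zero_le n) (by simp) (by simp [hm.n])
    (by simp [hm.n]) (by decide) rfl rfl fun i s' _ hi hf hr hI => ?_
  have e4 : s'.arr 4 = f := (hf.arr 4 rfl).trans h4
  have e2 : s'.reg 2 = 0 := (hf.reg 2 rfl).trans (by simp [hm.zero])
  refine Runs.load_seq (Runs.ite (T := 1) ?_ ?_) <;>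
    simp only [Test.Holds, State.setReg_reg, hr, e4, e2] <;> intro hb <;> simp at hb
  · refine Runs.copy (T := 0) (Or.inr ?_)
    simp [hr, hi, hb]
  · refine Runs.skip (T := 0) ?_
    rcases hI with ⟨h1, h2⟩ | hI
    · refine Or.inl ⟨by simpa using h1, fun v hv => ?_⟩
      rcases Nat.lt_succ_iff_lt_or_eq.1 hv with hv | rfl
      · exact h2 v hv
      · exact hb
    · exact Or.inr (by simpa using hI)

/-- Output the partition into classes if register `11` holds a vertex, and otherwise the partition
given by the host map. -/
def Prog.outputParts : Prog :=
  .ite (.lt 11 0)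
    (.const 3 0 ;; .upTo 3 0 (.load 7 2 3 ;; .store 3 3 7) ;; .succ 1 ;; .copy 0 1)
    (.const 3 0 ;; .upTo 3 0 (.load 7 4 3 ;; .pred 7 ;; .store 3 3 7) ;; .copy 0 1)

/-- Without a free vertex class `0` disappears and the hosts are numbered from `1`; the predecessor
shifts them to part indices from `0`. -/
theorem runs_outputParts {n k : ℕ} {off adj col f : ℕ → ℕ} {s : State}
    (hm : Memory n k off adj col s) (h4 : s.arr 4 = f) :
    Runs .outputParts s (fun s' =>
      (s.reg 11 < n → s'.reg 0 = k + 1 ∧ ∀ v < n, s'.arr 3 v = col v) ∧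
      (¬ s.reg 11 < n → s'.reg 0 = k ∧ ∀ v < n, s'.arr 3 v = f v - 1)) (5 * n + 5) := by
  have update_lt : ∀ {g g' : ℕ → ℕ} {i : ℕ}, (∀ v < i, g v = g' v) →
      ∀ v < i + 1, Function.update g i (g' i) v = g' v := by
    intro g g' i h v hv
    by_cases hvi : v = i
    · simp [hvi]
    · simpa [hvi] using h v (by omega)
  refine Runs.ite (T := 5 * n + 4) ?_ ?_ <;> simp only [Test.Holds, hm.n] <;> intro hb
  · refine Runs.mono (T := (4 * (n - 0) + 1 + 2) + 1) (Runs.const_seq (Runs.seq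
      (T := 4 * (n - 0) + 1) (U := 2) (Runs.upTo_const
      (fun i s' => ∀ v < i, s'.arr 3 v = col v) 2 (Nat.zero_le n) (by simp) (by simp [hm.n])
      (by simp) (by decide) rfl rfl fun i s' _ hi hf hr hI => ?_) fun s' hf hI => ?_))
      (fun _ _ h => h) (by omega)
    · have e2 : s'.arr 2 = col := (hf.arr 2 rfl).trans hm.col
      exact Runs.load_seq (Runs.store (T := 0) (by simpa [hr, e2] using update_lt hI))
    · have e1 : s'.reg 1 = k := (hf.reg 1 rfl).trans (by simp [hm.k])
      exact Runs.succ_seq (Runs.copy (T := 0) (by simpa [hb, e1] using hI))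
  · refine Runs.mono (T := (5 * (n - 0) + 1 + 1) + 1) (Runs.const_seq (Runs.seq
      (T := 5 * (n - 0) + 1) (U := 1) (Runs.upTo_const
      (fun i s' => ∀ v < i, s'.arr 3 v = f v - 1) 3 (Nat.zero_le n) (by simp) (by simp [hm.n])
      (by simp) (by decide) rfl rfl fun i s' _ hi hf hr hI => ?_) fun s' hf hI => ?_))
      (fun _ _ h => h) (by omega)
    · have e4 : s'.arr 4 = f := (hf.arr 4 rfl).trans h4
      exact Runs.load_seq (Runs.pred_seq (Runs.store (T := 0)
        (by simpa [hr, e4] using update_lt (g' := fun v => f v - 1) hI)))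
    · have e1 : s'.reg 1 = k := (hf.reg 1 rfl).trans (by simp [hm.k])
      exact Runs.copy (T := 0) (by simpa [hb, e1] using hI)

/-- Extend the set in array `3`, whose size is in register `14`, by one vertex from each class
other than `0`, among the vertices for which array `7` contains the number in register `12`. -/
def Prog.pick : Prog :=
  .const 13 1 ;; .store 8 2 13 ;; .const 3 0 ;;
    .upTo 3 0 (.load 8 7 3 ;; .ite (.eq 8 12)
      (.load 7 2 3 ;; .load 9 8 7 ;;
        .ite (.eq 9 2) (.store 8 7 13 ;; .store 3 3 13 ;; .succ 14) .skip)
      .skip) ;;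
    .copy 0 14

/-- Greedy choice: the first eligible vertex of each class is taken, and array `8` marks the classes
already settled. Marking class `0` beforehand keeps further center vertices out. The initial set
`S₀` will be empty or a single free vertex. -/
theorem runs_pick {n k : ℕ} {off adj col : ℕ → ℕ} {s : State} {ok : ℕ → Prop} {S₀ : Finset ℕ}
    (hm : Memory n k off adj col s) (h3 : s.arr 3 = fun v => if v ∈ S₀ then 1 else 0)
    (h14 : s.reg 14 = S₀.card) (h8 : s.arr 8 = fun _ => 0)
    (hok : ∀ w < n, s.arr 7 w = s.reg 12 ↔ ok w)
    (hS₀ : ∀ v ∈ S₀, col v = 0) (hinj : Set.InjOn col S₀) :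
    Runs .pick s (fun s' => ∃ S : Finset ℕ, S₀ ⊆ S ∧
      (∀ v ∈ S, v ∈ S₀ ∨ v < n ∧ col v ≠ 0 ∧ ok v) ∧ Set.InjOn col S ∧
      s'.reg 0 = S.card ∧ s'.arr 3 = (fun v => if v ∈ S then 1 else 0) ∧
      ∀ w < n, ok w → col w ≠ 0 → ∃ v ∈ S, col v = col w) (10 * n + 5) := by
  refine Runs.mono (T := 10 * (n - 0) + 1 + 1 + 1 + 1 + 1) (Runs.const_seq (Runs.store_seq
    (Runs.const_seq (Runs.seq (T := 10 * (n - 0) + 1) (U := 1) (Runs.upTo_const (fun i s' =>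
    ∃ S : Finset ℕ, S₀ ⊆ S ∧ (∀ v ∈ S, v ∈ S₀ ∨ v < i ∧ col v ≠ 0 ∧ ok v) ∧ Set.InjOn col S ∧
      s'.reg 14 = S.card ∧ s'.arr 3 = (fun v => if v ∈ S then 1 else 0) ∧
      (∀ c, s'.arr 8 c = 0 ↔ c ≠ 0 ∧ ∀ v ∈ S, col v ≠ c) ∧
      ∀ w < i, ok w → col w ≠ 0 → ∃ v ∈ S, col v = col w) 8 (Nat.zero_le n) (by simp)
      (by simp [hm.n]) ?_ (by decide) rfl rfl ?_) ?_)))) (fun _ _ h => h) (by omega)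
  · refine ⟨S₀, subset_rfl, fun v hv => Or.inl hv, hinj, by simp [h14], by simp [h3], fun c => ?_,
      by simp⟩
    by_cases hc : c = 0
    · simp [hm.zero, hc]
    · simpa [hm.zero, hc, h8] using fun v hv => by rw [hS₀ v hv]; exact Ne.symm hc
  · rintro i s' - hi hf hr ⟨S, hsub, hS, hSinj, e14, e3, e8, hcov⟩
    have e2 : s'.reg 2 = 0 := (hf.reg 2 rfl).trans (by simp [hm.zero])
    have e13 : s'.reg 13 = 1 := (hf.reg 13 rfl).trans (by simp)
    have e12 : s'.reg 12 = s.reg 12 := (hf.reg 12 rfl).trans (by simp)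
    have e7 : s'.arr 7 = s.arr 7 := (hf.arr 7 rfl).trans (by simp)
    have ec : s'.arr 2 = col := (hf.arr 2 rfl).trans (by simp [hm.col])
    have stay : (ok i → col i ≠ 0 → ∃ v ∈ S, col v = col i) →
        ∀ w < i + 1, ok w → col w ≠ 0 → ∃ v ∈ S, col v = col w := by
      intro h w hw
      rcases Nat.lt_succ_iff_lt_or_eq.1 hw with hw | rfl
      · exact hcov w hw
      · exact h
    have hS' : ∀ v ∈ S, v ∈ S₀ ∨ v < i + 1 ∧ col v ≠ 0 ∧ ok v := fun v hv =>
      (hS v hv).imp_right fun h => ⟨by omega, h.2⟩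
    refine Runs.load_seq (Runs.ite (T := 6) ?_ ?_) <;>
      simp only [Test.Holds, State.setReg_reg, hr, e7, e12] <;> intro hb <;>
      simp [hok i hi] at hb
    · refine Runs.load_seq (Runs.load_seq (Runs.ite (T := 3) ?_ ?_)) <;>
        simp only [Test.Holds, State.setReg_reg, State.setReg_arr, hr, ec, e2] <;>
        intro hb' <;> simp [e8] at hb'
      · have hiS : i ∉ S := fun h => hb'.2 i h rfl
        refine Runs.store_seq (Runs.store_seq (Runs.succ (T := 0) ?_))
        refine ⟨insert i S, hsub.trans (Finset.subset_insert _ _), ?_, ?_, ?_, ?_, ?_, ?_⟩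
        · intro v hv
          rcases Finset.mem_insert.1 hv with rfl | hv
          · exact Or.inr ⟨by omega, hb'.1, hb⟩
          · exact hS' v hv
        · rw [Finset.coe_insert, Set.injOn_insert (by simpa using hiS)]
          refine ⟨hSinj, ?_⟩
          rintro ⟨v, hv, hvi⟩
          exact hb'.2 v hv hvi
        · simp [e14, Finset.card_insert_of_notMem hiS]
        · funext v
          by_cases hvi : v = i <;> simp [hr, e13, e3, hvi]
        · intro c
          by_cases hc : c = col i
          · subst hc
            simp [hr, e13]
          · simp [hr, hc, e8, Ne.symm hc]
        · intro w hw h1 h2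
          by_cases hwi : w = i
          · exact ⟨i, by simp, by rw [hwi]⟩
          · obtain ⟨v, hv, hvw⟩ := hcov w (by omega) h1 h2
            exact ⟨v, by simp [hv], hvw⟩
      · exact Runs.skip ⟨S, hsub, hS', hSinj, by simp [e14], by simp [e3], by simpa using e8,
          stay fun _ h0 => hb' h0⟩
    · exact Runs.skip ⟨S, hsub, hS', hSinj, by simp [e14], by simp [e3], by simpa using e8,
        stay fun h => absurd h hb⟩
  · rintro s' - ⟨S, hsub, hS, hSinj, e14, e3, -, hcov⟩
    exact Runs.copy ⟨S, hsub, hS, hSinj, by simp [e14], by simp [e3], hcov⟩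

/-- Mark the neighbors of the vertex in register `11` in array `7`. -/
def Prog.markNeighbors : Prog :=
  .edges 11 ;; .const 13 1 ;; .upTo 4 5 (.load 6 1 4 ;; .store 7 6 13)

theorem runs_markNeighbors {n k : ℕ} {A : ℕ → ℕ → Prop} {off adj col : ℕ → ℕ} {s : State} {x : ℕ}
    (h : Input n k A off adj col) (hm : Memory n k off adj col s) (hx : x < n)
    (h11 : s.reg 11 = x) (h7 : s.arr 7 = fun _ => 0) :
    Runs .markNeighbors s (fun s' => s'.reg 13 = 1 ∧
      ∀ w < n, (A x w → s'.arr 7 w = 1) ∧ (¬ A x w → s'.arr 7 w = 0))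
      (4 * (off (x + 1) - off x) + 6) := by
  refine Runs.mono (T := 4 + (4 * (off (x + 1) - off x) + 1 + 1))
    (Runs.seq (runs_edges h11 (by decide) hm.off) fun s₁ f₁ ⟨h4, h5⟩ =>
    Runs.const_seq (Runs.upTo_const (fun i s' => s'.reg 13 = 1 ∧ ∀ w,
      ((∃ j, off x ≤ j ∧ j < i ∧ adj j = w) → s'.arr 7 w = 1) ∧
      ((¬ ∃ j, off x ≤ j ∧ j < i ∧ adj j = w) → s'.arr 7 w = 0)) 2 (h.off_le x hx) (by simp [h4])
      (by simp [h5]) ?_ (by decide) rfl rfl ?_)) ?_ (by omega)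
  · have e7 : s₁.arr 7 = fun _ => 0 := (f₁.arr 7 rfl).trans h7
    refine ⟨by simp, fun w => ⟨?_, by simp [e7]⟩⟩
    rintro ⟨j, h1, h2, -⟩
    omega
  · rintro i s' hi hi' hf hr ⟨e13, hI⟩
    have e1 : s'.arr 1 = adj := (hf.arr 1 rfl).trans ((f₁.arr 1 rfl).trans hm.adj)
    refine Runs.load_seq (Runs.store (T := 0) ⟨by simpa using e13, fun w => ?_⟩)
    by_cases hw : w = adj i
    · subst hw
      simp only [State.setReg_arr, State.setArr_arr, State.setReg_reg, hr, e1, e13]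
      exact ⟨by simp, fun hcon => absurd ⟨i, hi, by omega, rfl⟩ hcon⟩
    · have : (∃ j, off x ≤ j ∧ j < i + 1 ∧ adj j = w) ↔ ∃ j, off x ≤ j ∧ j < i ∧ adj j = w := by
        constructor
        · rintro ⟨j, h1, h2, rfl⟩
          refine ⟨j, h1, ?_, rfl⟩
          rcases Nat.lt_succ_iff_lt_or_eq.1 h2 with h2 | rfl
          · exact h2
          · exact absurd rfl hw
        · rintro ⟨j, h1, h2, rfl⟩
          exact ⟨j, h1, by omega, rfl⟩
      rw [this]
      simpa only [State.setReg_arr, State.setArr_arr, State.setReg_reg, hr, e1, if_true,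
        Function.update_of_ne hw] using hI w
  · rintro s' - ⟨e13, hI⟩
    refine ⟨e13, fun w hw => ?_⟩
    have : (∃ j, off x ≤ j ∧ j < off (x + 1) ∧ adj j = w) ↔ A x w := by
      constructor
      · rintro ⟨j, h1, h2, rfl⟩
        exact ((h.adj x hx).mapsTo ⟨h1, h2⟩).2
      · intro ha
        obtain ⟨j, hj, rfl⟩ := (h.adj x hx).surjOn ⟨hw, ha⟩
        exact ⟨j, hj.1, hj.2, rfl⟩
    rw [← this]
    exact hI w

/-- Output a set that consists of the vertex in register `11`, if there is one, and of one vertex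
from each class other than `0`, which is a neighbor of this vertex if `b = 1`, and a non-neighbor
if `b = 0`. -/
def Prog.outputSet (b : ℕ) : Prog :=
  .ite (.lt 11 0)
    (.markNeighbors ;; .store 3 11 13 ;; .const 14 1 ;; .const 12 b)
    (.const 14 0 ;; .const 12 0) ;;
  .pick

theorem Input.off_mono {n k : ℕ} {A : ℕ → ℕ → Prop} {off adj col : ℕ → ℕ}
    (h : Input n k A off adj col) {v w : ℕ} (hvw : v ≤ w) (hw : w ≤ n) : off v ≤ off w := by
  induction w, hvw using Nat.le_induction with
  | base => exact le_rfl
  | succ w _ ih => exact (ih (by omega)).trans (h.off_le w (by omega))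

/-- With either value of `b`, the eligible vertices are those not `R`-related to the free vertex:
unmarked ones if `R` is adjacency, marked ones if it is the negation. A free vertex has an eligible
one in every class by `IsHost.none`. -/
theorem runs_outputSet {n k b : ℕ} {A R : ℕ → ℕ → Prop} {off adj col f : ℕ → ℕ} {s : State}
    (h : Input n k A off adj col) (hm : Memory n k off adj col s)
    (hR : (b = 0 ∧ R = A) ∨ (b = 1 ∧ R = fun v w => ¬ A v w)) (hf : IsHostMap n k col R f)
    (hfree : (s.reg 11 = n ∧ ∀ v < n, f v ≠ 0) ∨ (s.reg 11 < n ∧ f (s.reg 11) = 0))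
    (h3 : s.arr 3 = fun _ => 0) (h7 : s.arr 7 = fun _ => 0) (h8 : s.arr 8 = fun _ => 0) :
    Runs (.outputSet b) s (fun s' => ∃ S : Finset ℕ, (∀ v ∈ S, v < n) ∧ Set.InjOn col S ∧
      s'.reg 0 = S.card ∧ s'.arr 3 = (fun v => if v ∈ S then 1 else 0) ∧
      (∀ c, 1 ≤ c → c ≤ k → ∃ v ∈ S, col v = c) ∧
      ((∃ x ∈ S, f x = 0 ∧ col x = 0 ∧ ∀ v ∈ S, v ≠ x → col v ≠ 0 ∧ ¬ R x v) ∨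
        ((∀ v < n, f v ≠ 0) ∧ ∀ v ∈ S, col v ≠ 0)))
      (4 * off n + 10 * n + 15) := by
  classical
  rcases hfree with ⟨h11, hfree⟩ | ⟨hx, hfx⟩
  · refine Runs.mono (T := 2 + 1 + (10 * n + 5)) (Runs.seq
      (Q := fun s' => s'.reg 14 = 0 ∧ s'.reg 12 = 0 ∧ s'.arr = s.arr) (Runs.ite ?_ ?_)
      fun s₁ f₁ ⟨e14, e12, ea⟩ => ?_) (fun _ _ h => h) (by omega)
    · intro hb
      simp [Test.Holds, h11, hm.n] at hb
    · exact fun _ => Runs.const_seq (Runs.const (T := 0) (by simp))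
    -- Nothing has been marked, so array `7` agrees with the `0` in register `12` everywhere and all
    -- vertices are eligible.
    · refine Runs.mono (runs_pick (ok := fun _ => True) (S₀ := ∅) (hm.frame f₁ rfl)
        (by simp [ea, h3]) (by simp [e14]) (by simp [ea, h8]) (by simp [ea, h7, e12])
        (by simp) (by simp)) ?_ le_rfl
      rintro s' - ⟨S, -, hS, hinj, e0, e3, hcov⟩
      simp only [Finset.notMem_empty, false_or] at hS
      refine ⟨S, fun v hv => (hS v hv).1, hinj, e0, e3, fun c hc hck => ?_,
        Or.inr ⟨hfree, fun v hv => (hS v hv).2.1⟩⟩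
      obtain ⟨w, hw, rfl⟩ := h.surj c hc hck
      exact hcov w hw trivial (by omega)
  · set x := s.reg 11 with hxdef
    have hcx : col x = 0 := by
      by_contra hne
      exact hne ((hf.eq_col x hx hne).symm.trans hfx)
    have hle := h.off_mono (show x + 1 ≤ n from hx) le_rfl
    refine Runs.mono (T := (4 * (off (x + 1) - off x) + 6 + 3) + 1 + (10 * n + 5)) (Runs.seq
      (Q := fun s' => s'.reg 14 = 1 ∧ s'.reg 12 = b ∧ s'.arr 3 = (fun v => if v = x then 1 else 0) ∧
        ∀ w < n, s'.arr 7 w = b ↔ ¬ R x w) (Runs.ite ?_ ?_)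
      fun s₁ f₁ ⟨e14, e12, e3, e7⟩ => ?_) (fun _ _ h => h) (by omega)
    · intro _
      refine Runs.seq (runs_markNeighbors h hm hx hxdef.symm h7) fun s₁ f₁ ⟨e13, e7⟩ =>
        Runs.store_seq (Runs.const_seq (Runs.const (T := 0) ⟨by simp, by simp, ?_, ?_⟩))
      · have e3 : s₁.arr 3 = fun _ => 0 := (f₁.arr 3 rfl).trans h3
        have e11 : s₁.reg 11 = x := f₁.reg 11 rfl
        funext v
        simp [e3, e11, e13, Function.update_apply]
      · intro w hw
        obtain ⟨h1, h0⟩ := e7 w hw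
        by_cases ha : A x w
        · rcases hR with ⟨rfl, rfl⟩ | ⟨rfl, rfl⟩ <;> simp [ha, h1 ha]
        · rcases hR with ⟨rfl, rfl⟩ | ⟨rfl, rfl⟩ <;> simp [ha, h0 ha]
    · intro hb
      simp only [Test.Holds, hm.n] at hb
      exact absurd hx hb
    · have e8 : s₁.arr 8 = fun _ => 0 := (f₁.arr 8 rfl).trans h8
      refine Runs.mono (runs_pick (ok := fun w => ¬ R x w) (S₀ := {x}) (hm.frame f₁ rfl)
        (by simp [e3]) (by simp [e14]) e8 (by simpa [e12] using e7) (by simp [hcx]) (by simp))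
        ?_ le_rfl
      rintro s' - ⟨S, hsub, hS, hinj, e0, e3, hcov⟩
      refine ⟨S, fun v hv => ?_, hinj, e0, e3, fun c hc hck => ?_, Or.inl ⟨x, hsub (by simp), hfx,
        hcx, fun v hv hvx => ?_⟩⟩
      · rcases hS v hv with hv | hv
        · rwa [Finset.mem_singleton.1 hv]
        · exact hv.1
      · obtain ⟨w, hw, rfl, hRw⟩ := (hf.isHost x hx hcx).none hfx c hc hck
        exact hcov w hw hRw (by omega)
      · rcases hS v hv with hv | hv
        · exact absurd (Finset.mem_singleton.1 hv) hvx
        · exact hv.2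

/-! ### Independent sets and clique covers of unipolar graphs -/

/-- `col` sends the center of a clique split of `G` to `0`, and its `k` peripheral cliques to
`1, …, k`. -/
structure IsSplitColoring {V : Type*} (G : SimpleGraph V) (k : ℕ) (col : V → ℕ) : Prop where
  le : ∀ v, col v ≤ k
  surj : ∀ c, 1 ≤ c → c ≤ k → ∃ v, col v = c
  adj : ∀ u v, col u = col v → u ≠ v → G.Adj u v
  not_adj : ∀ u v, col u ≠ col v → col u ≠ 0 → col v ≠ 0 → ¬ G.Adj u v

theorem IsCliqueSplit.isSplitColoring {V : Type*} {G : SimpleGraph V} {k : ℕ} {H : Set V}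
    {P : Fin k → Set V} (h : IsCliqueSplit G H P) {col : V → ℕ} (hH : ∀ v ∈ H, col v = 0)
    (hP : ∀ i, ∀ v ∈ P i, col v = i + 1) : IsSplitColoring G k col where
  le v := by
    rcases h.cover v with hv | ⟨i, hv⟩
    · simp [hH v hv]
    · rw [hP i v hv]
      omega
  surj c hc hck := by
    obtain ⟨v, hv⟩ := h.periph_nonempty ⟨c - 1, by omega⟩
    exact ⟨v, by rw [hP _ v hv, Nat.sub_add_cancel hc]⟩
  adj u v huv hne := by
    rcases h.cover u with hu | ⟨i, hu⟩ <;> rcases h.cover v with hv | ⟨j, hv⟩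
    · exact h.center_isClique hu hv hne
    · rw [hH u hu, hP j v hv] at huv
      omega
    · rw [hP i u hu, hH v hv] at huv
      omega
    · rw [hP i u hu, hP j v hv] at huv
      obtain rfl : i = j := Fin.ext (by omega)
      exact h.periph_isClique i hu hv hne
  not_adj u v huv hu0 hv0 := by
    rcases h.cover u with hu | ⟨i, hu⟩
    · exact absurd (hH u hu) hu0
    rcases h.cover v with hv | ⟨j, hv⟩
    · exact absurd (hH v hv) hv0
    refine h.no_edges i j ?_ u hu v hv
    rintro rfl
    exact huv ((hP i u hu).trans (hP i v hv).symm)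

theorem IsCliqueSplit.exists_color {V : Type*} {G : SimpleGraph V} {k : ℕ} {H : Set V}
    {P : Fin k → Set V} (h : IsCliqueSplit G H P) :
    ∃ col : V → ℕ, (∀ v, v ∈ H ↔ col v = 0) ∧ ∀ i v, v ∈ P i ↔ col v = i + 1 := by
  classical
  have hex : ∀ v, ∃ c : ℕ, (v ∈ H ↔ c = 0) ∧ ∀ i, v ∈ P i ↔ c = i + 1 := by
    intro v
    by_cases hv : v ∈ H
    · exact ⟨0, by simp [hv], fun i => iff_of_false
        (fun hi => Set.disjoint_left.1 (h.center_disjoint i) hv hi) (by omega)⟩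
    · obtain ⟨j, hj⟩ := (h.cover v).resolve_left hv
      refine ⟨j + 1, by simp [hv], fun i => ⟨fun hi => ?_, fun hi => ?_⟩⟩
      · by_contra hne
        exact Set.disjoint_left.1 (h.periph_disjoint i j fun e => hne (by rw [e])) hi hj
      · obtain rfl : j = i := Fin.ext (by omega)
        exact hj
  choose col h1 h2 using hex
  exact ⟨col, h1, fun i v => h2 v i⟩

/-- Weak duality: two vertices of an independent set cannot share a clique, so `f` is injective on
it. -/
theorem card_le_of_cliques {V : Type*} {G : SimpleGraph V} {f : V → ℕ} {C : Finset ℕ}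
    (hf : ∀ v, f v ∈ C) (hcl : ∀ u v, f u = f v → u ≠ v → G.Adj u v) {T : Finset V} (hT : G.IsIndepSet T) :
    T.card ≤ C.card :=
  Finset.card_le_card_of_injOn f (fun v _ => hf v) fun u hu v hv huv => by
    by_contra hne
    exact hT hu hv hne (hcl u v huv hne)

/-- The clique partition `f` gives the upper bound, and `g` shows that `S` is large enough to attain
it. They are separate because, without a free vertex, `f` is the host map while `g` is the original
coloring. -/
theorem indepNum_eq {V : Type*} [Finite V] {G : SimpleGraph V} {S : Finset V}
    (hS : G.IsIndepSet S) {f g : V → ℕ} {C : Finset ℕ} (hf : ∀ v, f v ∈ C)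
    (hcl : ∀ u v, f u = f v → u ≠ v → G.Adj u v) (hg : ∀ c ∈ C, ∃ v ∈ S, g v = c) :
    G.IsMaximumIndepSet S ∧ G.indepNum = C.card := by
  classical
  have hcard : C.card ≤ S.card :=
    (Finset.card_le_card fun c hc => Finset.mem_image.2 (hg c hc)).trans
      (Finset.card_image_le (f := g))
  have hmax : G.IsMaximumIndepSet S := ⟨hS, fun T hT => (card_le_of_cliques hf hcl hT).trans hcard⟩
  exact ⟨hmax, (SimpleGraph.maximumIndepSet_card_eq_indepNum S hmax).symm.trans
    (le_antisymm (card_le_of_cliques hf hcl hS) hcard)⟩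

/-! ### Optimal independent sets from a split coloring -/

section

variable {V : Type*} {G : SimpleGraph V} {k : ℕ} {col : V → ℕ}

/-- If `f` sends every vertex of the center to a peripheral clique that it can join, and every
other vertex to its own clique, then the fibers of `f` are cliques. -/
theorem IsSplitColoring.adj_of_host (h : IsSplitColoring G k col) {f : V → ℕ}
    (hcol : ∀ v, col v ≠ 0 → f v = col v)
    (hhost : ∀ v, col v = 0 → ∀ w, col w = f v → G.Adj v w) (u v : V) (huv : f u = f v)
    (hne : u ≠ v) : G.Adj u v := by
  by_cases hu : col u = 0 <;> by_cases hv : col v = 0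
  · exact h.adj u v (hu.trans hv.symm) hne
  · exact hhost u hu v (by rw [huv, hcol v hv])
  · exact (hhost v hv u (by rw [← huv, hcol u hu])).symm
  · exact h.adj u v (by rw [← hcol u hu, ← hcol v hv, huv]) hne

theorem IsSplitColoring.isIndepSet (h : IsSplitColoring G k col) {S : Set V}
    (hinj : Set.InjOn col S) (hS : ∀ u ∈ S, col u = 0 → ∀ v ∈ S, v ≠ u → ¬ G.Adj u v) :
    G.IsIndepSet S := by
  intro u hu v hv hne
  by_cases hu0 : col u = 0
  · exact hS u hu hu0 v hv hne.symm
  by_cases hv0 : col v = 0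
  · exact fun ha => hS v hv hv0 u hu hne ha.symm
  exact h.not_adj u v (fun he => hne (hinj hu hv he)) hu0 hv0

theorem IsSplitColoring.isMaximumIndepSet_of_free [Finite V] (h : IsSplitColoring G k col)
    {S : Finset V} (hinj : Set.InjOn col S) (hcov : ∀ c, 1 ≤ c → c ≤ k → ∃ v ∈ S, col v = c)
    {x : V} (hx : x ∈ S) (hx0 : col x = 0) (hfree : ∀ v ∈ S, v ≠ x → ¬ G.Adj x v) :
    G.IsMaximumIndepSet S ∧ G.indepNum = k + 1 := by
  have := indepNum_eq (h.isIndepSet hinj fun u hu hu0 v hv hne => by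
    obtain rfl : u = x := hinj hu hx (hu0.trans hx0.symm)
    exact hfree v hv hne) (C := Finset.Icc 0 k) (fun v => by simp [h.le v]) h.adj (g := col) ?_
  · simpa using this
  · intro c hc
    rcases Nat.eq_zero_or_pos c with rfl | hc0
    · exact ⟨x, hx, hx0⟩
    · exact hcov c hc0 (Finset.mem_Icc.1 hc).2

theorem IsSplitColoring.isMaximumIndepSet_of_host [Finite V] (h : IsSplitColoring G k col)
    {S : Finset V} (hinj : Set.InjOn col S) (hcov : ∀ c, 1 ≤ c → c ≤ k → ∃ v ∈ S, col v = c)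
    (hS0 : ∀ v ∈ S, col v ≠ 0) {f : V → ℕ} (hf0 : ∀ v, f v ≠ 0) (hfk : ∀ v, f v ≤ k)
    (hcol : ∀ v, col v ≠ 0 → f v = col v)
    (hhost : ∀ v, col v = 0 → ∀ w, col w = f v → G.Adj v w) :
    G.IsMaximumIndepSet S ∧ G.indepNum = k := by
  have := indepNum_eq (h.isIndepSet hinj fun u hu hu0 => absurd hu0 (hS0 u hu))
    (C := Finset.Icc 1 k) (fun v => Finset.mem_Icc.2 ⟨Nat.pos_of_ne_zero (hf0 v), hfk v⟩)
    (h.adj_of_host hcol hhost) (g := col) fun c hc =>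
      hcov c (Finset.mem_Icc.1 hc).1 (Finset.mem_Icc.1 hc).2
  simpa using this

/-- Every choice of representatives of the peripheral cliques gives a set as in the two preceding
theorems. -/
theorem exists_representatives (col : V → ℕ) {ok : V → Prop}
    (hok : ∀ c, 1 ≤ c → c ≤ k → ∃ v, col v = c ∧ ok v) :
    ∃ S : Finset V, Set.InjOn col S ∧ (∀ v ∈ S, col v ≠ 0 ∧ ok v) ∧
      ∀ c, 1 ≤ c → c ≤ k → ∃ v ∈ S, col v = c := by
  classical
  have hex : ∀ i : Fin k, ∃ v, col v = i + 1 ∧ ok v := fun i => hok _ (by omega) (by omega)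
  choose g hg hgok using hex
  refine ⟨Finset.univ.image g, ?_, ?_, fun c hc hck => ?_⟩
  · intro u hu v hv huv
    simp only [Finset.coe_image, Finset.coe_univ, Set.image_univ, Set.mem_range] at hu hv
    obtain ⟨i, rfl⟩ := hu
    obtain ⟨j, rfl⟩ := hv
    rw [hg, hg] at huv
    rw [Fin.ext (by omega : (i : ℕ) = j)]
  · intro v hv
    obtain ⟨i, -, rfl⟩ := Finset.mem_image.1 hv
    exact ⟨by rw [hg]; omega, hgok i⟩
  · exact ⟨_, Finset.mem_image_of_mem g (Finset.mem_univ ⟨c - 1, by omega⟩),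
      by rw [hg]; exact Nat.sub_add_cancel hc⟩

theorem IsSplitColoring.indepNum_of_free [Finite V] (h : IsSplitColoring G k col) {x : V}
    (hx0 : col x = 0) (hfree : ∀ c, 1 ≤ c → c ≤ k → ∃ v, col v = c ∧ ¬ G.Adj x v) :
    G.indepNum = k + 1 := by
  classical
  obtain ⟨S, hinj, hS, hcov⟩ := exists_representatives col hfree
  refine (h.isMaximumIndepSet_of_free (S := insert x S) (x := x) ?_ (fun c hc hck => ?_) (by simp)
    hx0 fun v hv hvx => ?_).2
  · rw [Finset.coe_insert, Set.injOn_insert fun hx => (hS x hx).1 hx0]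
    refine ⟨hinj, ?_⟩
    rintro ⟨v, hv, hvx⟩
    exact (hS v hv).1 (hvx.trans hx0)
  · obtain ⟨v, hv, hvc⟩ := hcov c hc hck
    exact ⟨v, by simp [hv], hvc⟩
  · exact (hS v (Finset.mem_of_mem_insert_of_ne hv hvx)).2

theorem IsSplitColoring.indepNum_of_host [Finite V] (h : IsSplitColoring G k col) {f : V → ℕ}
    (hf0 : ∀ v, f v ≠ 0) (hfk : ∀ v, f v ≤ k) (hcol : ∀ v, col v ≠ 0 → f v = col v)
    (hhost : ∀ v, col v = 0 → ∀ w, col w = f v → G.Adj v w) : G.indepNum = k := by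
  obtain ⟨S, hinj, hS, hcov⟩ := exists_representatives col (ok := fun _ => True)
    fun c hc hck => (h.surj c hc hck).imp fun v hv => ⟨hv, trivial⟩
  exact (h.isMaximumIndepSet_of_host hinj hcov (fun v hv => (hS v hv).1) hf0 hfk hcol hhost).2

end

/-- The independence number of a graph with a clique split. -/
theorem IsCliqueSplit.indepNum_eq {V : Type*} [Finite V] {G : SimpleGraph V} {k : ℕ} {H : Set V}
    {P : Fin k → Set V} (h : IsCliqueSplit G H P) :
    ((∃ x ∈ H, ∀ i, ∃ y ∈ P i, ¬ G.Adj x y) → G.indepNum = k + 1) ∧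
      (¬ (∃ x ∈ H, ∀ i, ∃ y ∈ P i, ¬ G.Adj x y) → G.indepNum = k) := by
  classical
  obtain ⟨col, hH, hP⟩ := h.exists_color
  have hc := h.isSplitColoring (fun v hv => (hH v).1 hv) fun i v hv => (hP i v).1 hv
  constructor
  · rintro ⟨x, hx, hxP⟩
    refine hc.indepNum_of_free ((hH x).1 hx) fun c hc hck => ?_
    obtain ⟨y, hy, hxy⟩ := hxP ⟨c - 1, by omega⟩
    exact ⟨y, by rw [(hP _ y).1 hy]; exact Nat.sub_add_cancel hc, hxy⟩
  · intro hno
    push Not at hno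
    have hex : ∀ v, ∃ c, c ≠ 0 ∧ c ≤ k ∧ (col v ≠ 0 → c = col v) ∧
        (col v = 0 → ∀ w, col w = c → G.Adj v w) := by
      intro v
      by_cases hv : col v = 0
      · obtain ⟨i, hi⟩ := hno v ((hH v).2 hv)
        exact ⟨i + 1, by omega, by omega, fun h => absurd hv h,
          fun _ w hw => hi w ((hP i w).2 hw)⟩
      · exact ⟨col v, hv, hc.le v, fun _ => rfl, fun h => absurd h hv⟩
    choose f h1 h2 h3 h4 using hex
    exact hc.indepNum_of_host h1 h2 h3 h4

/-! ### Correctness and running time -/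

/-- The adjacency relation of a graph on `Fin n`, as a relation on the natural numbers. -/
def natAdj {n : ℕ} (G : SimpleGraph (Fin n)) (v w : ℕ) : Prop :=
  ∃ (hv : v < n) (hw : w < n), G.Adj ⟨v, hv⟩ ⟨w, hw⟩

@[simp] theorem natAdj_coe {n : ℕ} (G : SimpleGraph (Fin n)) (v w : Fin n) :
    natAdj G v w ↔ G.Adj v w := by
  simp [natAdj]

/-! ### From encoded graphs to the programs -/

section

variable {n k : ℕ} {G G' : SimpleGraph (Fin n)} {H : Set (Fin n)} {P : Fin k → Set (Fin n)}
  {s : State}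

/-- `G` is the graph whose adjacency lists are stored, `G'` the graph that is split; in the
applications `G'` is `G` or `Gᶜ`. -/
theorem Encodes.isSplitColoring (he : Encodes G H P s) (hs : IsCliqueSplit G' H P) :
    IsSplitColoring G' k fun v : Fin n => s.arr 2 v :=
  hs.isSplitColoring he.center he.periph

theorem Encodes.input (he : Encodes G H P s) (hs : IsCliqueSplit G' H P) :
    Input n k (natAdj G) (s.arr 0) (s.arr 1) (s.arr 2) where
  irrefl v := by
    rintro ⟨hv, _, ha⟩
    exact G.irrefl ha
  off_le v hv := he.off_le ⟨v, hv⟩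
  adj v hv := by
    have := he.adj ⟨v, hv⟩
    convert this using 1
    ext w
    constructor
    · rintro ⟨hw, ha⟩
      exact ⟨⟨w, hw⟩, (natAdj_coe G ⟨v, hv⟩ ⟨w, hw⟩).1 ha, rfl⟩
    · rintro ⟨w, ha, rfl⟩
      exact ⟨w.2, (natAdj_coe G ⟨v, hv⟩ w).2 ha⟩
  col_le v hv := (he.isSplitColoring hs).le ⟨v, hv⟩
  surj c hc hck := by
    obtain ⟨v, hv⟩ := (he.isSplitColoring hs).surj c hc hck
    exact ⟨v, v.2, hv⟩

theorem Encodes.memory (he : Encodes G H P s) :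
    Memory n k (s.arr 0) (s.arr 1) (s.arr 2) s :=
  ⟨he.reg_n, he.reg_k, he.reg_other 2 le_rfl, rfl, rfl, rfl⟩

/-- Handshake lemma: consecutive offsets differ by a degree, so the last one is the degree sum. -/
theorem Encodes.off_last (he : Encodes G H P s) : s.arr 0 n = 2 * G.edgeSet.ncard := by
  classical
  have hdeg : ∀ v : Fin n, s.arr 0 (v + 1) = s.arr 0 v + G.degree v := by
    intro v
    have hb := he.adj v
    have h1 := hb.injOn.ncard_image
    rw [hb.image_eq, Set.ncard_image_of_injective _ Fin.val_injective,
      Set.ncard_eq_toFinset_card', Set.ncard_eq_toFinset_card', Set.toFinset_Ico, Nat.card_Ico] at h1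
    have h2 : G.degree v = (G.neighborSet v).toFinset.card := by
      rw [Set.toFinset_card, G.card_neighborSet_eq_degree]
    have := he.off_le v
    omega
  have hsum : ∀ m (hm : m ≤ n), s.arr 0 m = ∑ v : Fin m, G.degree (v.castLE hm) := by
    intro m
    induction m with
    | zero => simp [he.off_zero]
    | succ m ih =>
      intro hm
      rw [Fin.sum_univ_castSucc, hdeg ⟨m, hm⟩, ih (by omega)]
      rfl
  rw [hsum n le_rfl, Set.ncard_eq_toFinset_card', ← SimpleGraph.edgeFinset,
    ← G.sum_degrees_eq_twice_card_edges]
  rfl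


/-- `R` sends the adjacency relation of `G` to that of `G'`. -/
def Transfers (R : (ℕ → ℕ → Prop) → ℕ → ℕ → Prop) (G G' : SimpleGraph (Fin n)) : Prop :=
  ∀ u v : Fin n, u ≠ v → (R (natAdj G) u v ↔ G'.Adj u v)

theorem transfers_self (G : SimpleGraph (Fin n)) : Transfers (fun A => A) G G :=
  fun u v _ => natAdj_coe G u v

theorem transfers_compl (G : SimpleGraph (Fin n)) : Transfers (fun A v w => ¬ A v w) G Gᶜ :=
  fun u v h => by simp [h]

/-- Compute the host map, and a vertex without a host if there is one. -/
def Prog.prepare (p : Prog) : Prog := .countClasses ;; .findHosts p ;; .findFree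

theorem Encodes.runs_prepare (he : Encodes G H P s) (hs : IsCliqueSplit G' H P) {p : Prog}
    {R : (ℕ → ℕ → Prop) → ℕ → ℕ → Prop} (hp : p.FindsHost R) :
    Runs (.prepare p) s (fun s' => Memory n k (s.arr 0) (s.arr 1) (s.arr 2) s' ∧
      IsHostMap n k (s.arr 2) (R (natAdj G)) (s'.arr 4) ∧
      ((s'.reg 11 = n ∧ ∀ v < n, s'.arr 4 v ≠ 0) ∨ (s'.reg 11 < n ∧ s'.arr 4 (s'.reg 11) = 0)) ∧
      s'.arr 3 = (fun _ => 0) ∧ s'.arr 7 = (fun _ => 0) ∧ s'.arr 8 = fun _ => 0)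
      (20 * s.arr 0 n + 39 * n + 7) := by
  have h := he.input hs
  have zero : ∀ a, 3 ≤ a → s.arr a = fun _ => 0 := fun a ha => funext (he.arr_other a ha)
  refine Runs.mono (T := 6 * n + 2 + (20 * s.arr 0 n + 28 * n + 2 + (5 * n + 3))) ?_
    (fun _ _ h => h) (by omega)
  refine Runs.seq (runs_countClasses he.memory (zero 5 (by omega))) fun s₁ f₁ h5 => ?_
  have m₁ := he.memory.frame f₁ rfl
  refine Runs.seq (runs_findHosts hp h m₁ h5 ((f₁.arr 6 rfl).trans (zero 6 (by omega))))
    fun s₂ f₂ h4 => ?_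
  have m₂ := m₁.frame f₂ (keepsInput_findHosts hp)
  refine Runs.mono (runs_findFree m₂ rfl) (fun s₃ f₃ hfree => ?_) le_rfl
  have e4 : s₃.arr 4 = s₂.arr 4 := f₃.arr 4 rfl
  rw [e4]
  refine ⟨m₂.frame f₃ rfl, h4, hfree, ?_, ?_, ?_⟩
  · exact (f₃.arr 3 rfl).trans ((f₂.arr 3 (keepsArr_findHosts hp (by decide) (by decide))).trans
      ((f₁.arr 3 rfl).trans (zero 3 (by omega))))
  · exact (f₃.arr 7 rfl).trans ((f₂.arr 7 (keepsArr_findHosts hp (by decide) (by decide))).trans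
      ((f₁.arr 7 rfl).trans (zero 7 (by omega))))
  · exact (f₃.arr 8 rfl).trans ((f₂.arr 8 (keepsArr_findHosts hp (by decide) (by decide))).trans
      ((f₁.arr 8 rfl).trans (zero 8 (by omega))))

theorem IsHostMap.adj {R : (ℕ → ℕ → Prop) → ℕ → ℕ → Prop} {f : ℕ → ℕ} {col : ℕ → ℕ}
    (hf : IsHostMap n k col (R (natAdj G)) f) (hR : Transfers R G G')
    (hf0 : ∀ v < n, f v ≠ 0) (v : Fin n) (hv : col v = 0) (w : Fin n) (hw : col w = f v) :
    G'.Adj v w := by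
  have hne := hf0 v v.2
  refine (hR v w ?_).1 ((hf.isHost v v.2 hv).rel hne w w.2 hw)
  -- `Transfers` says nothing on the diagonal, where the negated adjacency and `Gᶜ` differ. Here `w
  -- ≠ v` because `v` has color `0` and its host does not.
  rintro rfl
  exact hne (hw.symm.trans hv)

theorem IsHostMap.le {R : ℕ → ℕ → Prop} {f : ℕ → ℕ} {col : ℕ → ℕ} (hf : IsHostMap n k col R f)
    (hcol : ∀ v < n, col v ≤ k) {v : ℕ} (hv : v < n) : f v ≤ k := by
  by_cases h0 : col v = 0
  · exact (hf.isHost v hv h0).le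
  · rw [hf.eq_col v hv h0]
    exact hcol v hv

theorem Encodes.runs_maximumIndepSet (he : Encodes G H P s) (hs : IsCliqueSplit G' H P) {p : Prog}
    {R : (ℕ → ℕ → Prop) → ℕ → ℕ → Prop} (hp : p.FindsHost R) (hR : Transfers R G G') {b : ℕ}
    (hb : (b = 0 ∧ R (natAdj G) = natAdj G) ∨
      (b = 1 ∧ R (natAdj G) = fun v w => ¬ natAdj G v w)) :
    Runs (.prepare p ;; .outputSet b) s
      (fun s' => ∃ S : Finset (Fin n), G'.IsMaximumIndepSet S ∧ OutputsSet s' S)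
      (49 * (n + G.edgeSet.ncard + 1)) := by
  have h := he.input hs
  have hc := he.isSplitColoring hs
  have hlast := he.off_last
  -- With `m` edges the last offset is `2 * m`, so the total is `48 * m + 49 * n + 22`; hence the
  -- constant `49`.
  refine Runs.mono (T := 20 * s.arr 0 n + 39 * n + 7 + (4 * s.arr 0 n + 10 * n + 15)) ?_
    (fun _ _ h => h) (by omega)
  refine Runs.seq (he.runs_prepare hs hp) fun s₁ _ ⟨hm, hf, hfree, h3, h7, h8⟩ => ?_
  refine Runs.mono (runs_outputSet h hm hb hf hfree h3 h7 h8) ?_ le_rfl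
  rintro s' - ⟨S, hSn, hinj, e0, e3, hcov, hcase⟩
  set T : Finset (Fin n) := S.attachFin hSn with hT
  have hinjT : Set.InjOn (fun v : Fin n => s.arr 2 v) T := fun u hu v hv huv =>
    Fin.ext (hinj (Finset.mem_attachFin hSn |>.1 hu) (Finset.mem_attachFin hSn |>.1 hv) huv)
  have hcovT : ∀ c, 1 ≤ c → c ≤ k → ∃ v ∈ T, s.arr 2 v = c := by
    intro c hc hck
    obtain ⟨v, hv, hvc⟩ := hcov c hc hck
    exact ⟨⟨v, hSn v hv⟩, (Finset.mem_attachFin hSn).2 hv, hvc⟩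
  refine ⟨T, ?_, by simp [e0, hT], fun v => by simp [e3, hT]⟩
  rcases hcase with ⟨x, hxS, -, hx0, hx⟩ | ⟨hf0, hS0⟩
  · refine (hc.isMaximumIndepSet_of_free hinjT hcovT (x := ⟨x, hSn x hxS⟩)
      ((Finset.mem_attachFin hSn).2 hxS) hx0 fun v hv hvx ha => ?_).1
    exact (hx v ((Finset.mem_attachFin hSn).1 hv) fun e => hvx (Fin.ext e)).2
      ((hR ⟨x, hSn x hxS⟩ v hvx.symm).2 ha)
  · exact (hc.isMaximumIndepSet_of_host hinjT hcovT
      (fun v hv => hS0 v ((Finset.mem_attachFin hSn).1 hv)) (f := fun v => s₁.arr 4 v)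
      (fun v => hf0 v v.2) (fun v => hf.le h.col_le v.2) (fun v hv => hf.eq_col v v.2 hv)
      (fun v hv w hw => hf.adj hR hf0 v hv w hw)).1

theorem Encodes.runs_cliqueCover (he : Encodes G H P s) (hs : IsCliqueSplit G' H P) {p : Prog}
    {R : (ℕ → ℕ → Prop) → ℕ → ℕ → Prop} (hp : p.FindsHost R) (hR : Transfers R G G') :
    Runs (.prepare p ;; .outputParts) s
      (fun s' => ∃ part : Fin n → Fin G'.indepNum,
        (∀ u v, part u = part v → u ≠ v → G'.Adj u v) ∧ OutputsParts s' G'.indepNum part)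
      (44 * (n + G.edgeSet.ncard + 1)) := by
  have h := he.input hs
  have hc := he.isSplitColoring hs
  have hlast := he.off_last
  refine Runs.mono (T := 20 * s.arr 0 n + 39 * n + 7 + (5 * n + 5)) ?_
    (fun _ _ h => h) (by omega)
  refine Runs.seq (he.runs_prepare hs hp) fun s₁ _ ⟨hm, hf, hfree, h3, h7, h8⟩ => ?_
  refine Runs.mono (runs_outputParts hm rfl) ?_ le_rfl
  rintro s' - ⟨hlt, hge⟩
  rcases hfree with ⟨h11, hf0⟩ | ⟨hx, hfx⟩
  · obtain ⟨e0, e3⟩ := hge (by omega)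
    have hle : ∀ v : Fin n, s₁.arr 4 v ≤ k := fun v => hf.le h.col_le v.2
    have hcol : ∀ v : Fin n, s.arr 2 v ≠ 0 → s₁.arr 4 v = s.arr 2 v :=
      fun v hv => hf.eq_col v v.2 hv
    have hk : G'.indepNum = k := hc.indepNum_of_host (f := fun v => s₁.arr 4 v)
      (fun v => hf0 v v.2) hle hcol (hf.adj hR hf0)
    rw [hk]
    refine ⟨fun v => ⟨s₁.arr 4 v - 1, ?_⟩, fun u v huv => ?_, e0, fun v => e3 v v.2⟩
    · have := hle v
      have := hf0 v v.2
      omega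
    · have h1 := hf0 u u.2
      have h2 := hf0 v v.2
      rw [Fin.mk.injEq] at huv
      exact hc.adj_of_host (f := fun v => s₁.arr 4 v) hcol (hf.adj hR hf0) u v (by omega)
  · obtain ⟨e0, e3⟩ := hlt hx
    have hx0 : s.arr 2 (s₁.reg 11) = 0 := by
      by_contra hne
      exact hne ((hf.eq_col _ hx hne).symm.trans hfx)
    have hk : G'.indepNum = k + 1 := by
      refine hc.indepNum_of_free (x := ⟨_, hx⟩) hx0 fun c hc1 hck => ?_
      obtain ⟨w, hw, hwc, hnR⟩ := (hf.isHost _ hx hx0).none hfx c hc1 hck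
      refine ⟨⟨w, hw⟩, hwc, fun ha => hnR ((hR ⟨_, hx⟩ ⟨w, hw⟩ ha.ne).2 ha)⟩
    rw [hk]
    refine ⟨fun v => ⟨s.arr 2 v, Nat.lt_succ_of_le (hc.le v)⟩, fun u v huv => ?_, e0,
      fun v => e3 v v.2⟩
    exact hc.adj u v (Fin.mk.inj_iff.1 huv)

end

/-- Weak duality again: assigning each vertex to one clique of a competing cover maps a maximum
independent set injectively into the cover. -/
theorem isMinimumCliqueCover_of_indepNum {V : Type*} [Finite V] {G : SimpleGraph V}
    {part : V → Fin G.indepNum} (h : ∀ u v, part u = part v → u ≠ v → G.Adj u v) :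
    IsMinimumCliqueCover G fun i => {v | part v = i} := by
  refine ⟨⟨fun i u hu v hv hne => h u v (hu.trans hv.symm) hne, fun v => ⟨part v, rfl⟩⟩, ?_⟩
  rintro r K ⟨hK, hcov⟩
  choose f hf using hcov
  obtain ⟨S, hS⟩ := G.exists_isNIndepSet_indepNum
  rw [← hS.card_eq]
  have := card_le_of_cliques (f := fun v => (f v : ℕ)) (C := Finset.range r) (by simp)
    (fun u v huv hne => hK (f u) (hf u) (by rw [Fin.ext huv]; exact hf v) hne) hS.isIndepSet
  simpa using this

/-- The independence number of `Gᶜ` is the clique number of `G`, a lower bound for the number of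
colors that the coloring `c` attains. -/
theorem chromaticNumber_eq_of_compl {V : Type*} [Finite V] {G : SimpleGraph V}
    (c : G.Coloring (Fin Gᶜ.indepNum)) : (Gᶜ.indepNum : ℕ∞) = G.chromaticNumber := by
  refine le_antisymm ?_ (by simpa using c.colorable.chromaticNumber_le)
  rw [SimpleGraph.indepNum_compl]
  exact SimpleGraph.cliqueNum_le_chromaticNumber

end UnipolarAlg

theorem mainTheorem4 :
    -- the independence number of a graph with a clique split
    (∀ {V : Type*} [Fintype V] (G : SimpleGraph V) (k : ℕ) (H : Set V) (P : Fin k → Set V),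
      UnipolarAlg.IsCliqueSplit G H P →
        ((∃ x ∈ H, ∀ i, ∃ y ∈ P i, ¬ G.Adj x y) → G.indepNum = k + 1) ∧
        (¬ (∃ x ∈ H, ∀ i, ∃ y ∈ P i, ¬ G.Adj x y) → G.indepNum = k)) ∧
    -- maximum independent set, given a clique split of the graph
    (∃ p : UnipolarAlg.Prog, UnipolarAlg.SolvesInLinearTime p
      (fun G H P => UnipolarAlg.IsCliqueSplit G H P)
      (fun {n} G s => ∃ S : Finset (Fin n), G.IsMaximumIndepSet S ∧
        UnipolarAlg.OutputsSet s S)) ∧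
    -- minimum clique cover, of size the independence number, given a clique split of the graph
    (∃ p : UnipolarAlg.Prog, UnipolarAlg.SolvesInLinearTime p
      (fun G H P => UnipolarAlg.IsCliqueSplit G H P)
      (fun {n} G s => ∃ part : Fin n → Fin G.indepNum,
        UnipolarAlg.IsMinimumCliqueCover G (fun i => {v | part v = i}) ∧
        UnipolarAlg.OutputsParts s G.indepNum part)) ∧
    -- maximum clique, given a clique split of the complement
    (∃ p : UnipolarAlg.Prog, UnipolarAlg.SolvesInLinearTime p
      (fun G H P => UnipolarAlg.IsCliqueSplit Gᶜ H P)
      (fun {n} G s => ∃ S : Finset (Fin n), G.IsMaximumClique S ∧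
        UnipolarAlg.OutputsSet s S)) ∧
    -- minimum coloring, given a clique split of the complement
    (∃ p : UnipolarAlg.Prog, UnipolarAlg.SolvesInLinearTime p
      (fun G H P => UnipolarAlg.IsCliqueSplit Gᶜ H P)
      (fun {n} G s => ∃ (r : ℕ) (c : G.Coloring (Fin r)), (r : ℕ∞) = G.chromaticNumber ∧
        UnipolarAlg.OutputsParts s r c)) := by
  refine ⟨fun G k H P h => h.indepNum_eq,
    ⟨.prepare .fullClass ;; .outputSet 0, 49, fun n k G H P s hs he => ?_⟩,
    ⟨.prepare .fullClass ;; .outputParts, 44, fun n k G H P s hs he => ?_⟩,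
    ⟨.prepare .missedClass ;; .outputSet 1, 49, fun n k G H P s hs he => ?_⟩,
    ⟨.prepare .missedClass ;; .outputParts, 44, fun n k G H P s hs he => ?_⟩⟩
  · exact he.runs_maximumIndepSet hs UnipolarAlg.findsHost_fullClass
      (UnipolarAlg.transfers_self G) (Or.inl ⟨rfl, rfl⟩)
  · exact (he.runs_cliqueCover hs UnipolarAlg.findsHost_fullClass
      (UnipolarAlg.transfers_self G)).mono (fun s' _ ⟨part, h, hout⟩ =>
        ⟨part, UnipolarAlg.isMinimumCliqueCover_of_indepNum h, hout⟩) le_rfl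
  · exact (he.runs_maximumIndepSet hs UnipolarAlg.findsHost_missedClass
      (UnipolarAlg.transfers_compl G) (Or.inr ⟨rfl, rfl⟩)).mono (fun s' _ ⟨S, h, hout⟩ =>
        ⟨S, (SimpleGraph.isMaximumIndepSet_compl S).1 h, hout⟩) le_rfl
  · exact (he.runs_cliqueCover hs UnipolarAlg.findsHost_missedClass
      (UnipolarAlg.transfers_compl G)).mono (fun s' _ ⟨part, h, hout⟩ =>
        -- Cliques of `Gᶜ` are independent in `G`, so the parts of the cover are color classes of a
        -- proper coloring.
        let c := SimpleGraph.Coloring.mk part fun {u v} ha he =>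
          ((SimpleGraph.compl_adj G u v).1 (h u v he ha.ne)).2 ha
        ⟨_, c, UnipolarAlg.chromaticNumber_eq_of_compl c, hout⟩) le_rfl
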